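/- Let $V\subset\mathbb R^d$ be a discrete additive subgroup (a locally finite lattice) and let $S\subset V$, $S\neq\{0\}$, be such that every element of $V$ is a finite sum of elements of $S$. Let $\mathfrak h\neq\{0\}$ be a finite-dimensional complex Hilbert space and let $(L_s)_{s\in S}$ be operators on $\mathfrak h$ with $\sum_{s\in S}L_s^*L_s=\mathrm{Id}$. Assume that $\sum_{s\in S}e^{\langle u,s\rangle}\|L_s\|^2<\infty$ for every $u\in\mathbb R^d$ (this is automatic when $S$ is finite). Let $\mathfrak L(\rho)=\sum_{s\in S}L_s\rho L_s^*$, and assume that $\mathfrak L$ is irreducible: the only orthogonal projections $P$ on $\mathfrak h$ such that for every operator $X$ the operator $\mathfrak L(PXP)$ is of the form $PYP$ are $P=0$ and $P=\mathrm{Id}$. Then $\mathfrak L$ has a unique invariant state $\rho^{\rm inv}$ (positive operator of trace one with $\mathfrak L(\rho^{\rm inv})=\rho^{\rm inv}$), and the series $$m=\sum_{s\in S}\mathrm{Tr}(L_s\rho^{\rm inv}L_s^*)\,s$$ converges. Let moreover $(\rho(i))_{i\in V}$ be any family of positive operators on $\mathfrak h$ with $\sum_{i\in V}\mathrm{Tr}\,\rho(i)=1$,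 that is, an initial state $\rho=\sum_{i\in V}\rho(i)\otimes|i\rangle\langle i|$. Let $\mathbb P=\mathbb P_\rho$ be the unique probability measure on $V^{\mathbb N}$ such that the coordinate process $(X_p)_{p\ge0}$ satisfies, for all $p\ge 0$ and $x_0,\dots,x_p\in V$, $$\mathbb P(X_0=x_0,\dots,X_p=x_p)=\mathrm{Tr}\big(L_{s_p}\cdots L_{s_1}\,\rho(x_0)\,L_{s_1}^*\cdots L_{s_p}^*\big)$$ if all the increments $s_k=x_k-x_{k-1}$ ($1\le k\le p$) belong to $S$, and $0$ otherwise (the position process of the open quantum random walk defined by the $L_s$). Then: 1. $\frac1p(X_p-X_0)$ converges exponentially fast to $m$: for every $\varepsilon>0$ there is $N>0$ such that, for all large enough $p$, $$\mathbb P\Big(\Big\|\frac{X_p-X_0}{p}-m\Big\|>\varepsilon\Big)\le e^{-pN}.$$ 2. $X_p/p\to m$ $\mathbb P$-almost surely as $p\to\infty$. -/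

import Mathlib

open MeasureTheory ProbabilityTheory Filter Topology ContinuousLinearMap
open scoped InnerProductSpace

set_option linter.unusedSectionVars false

noncomputable section

namespace OpenQuantumWalk

/-- A homogeneous open quantum random walk on the lattice `V ⊆ ℝ^d` with internal space `𝔥`:
a step set `S ⊆ V`, `S ≠ {0}`, such that every element of `V` is a sum of elements of `S`, and
transition operators `L_s` on `𝔥` with `∑_{s ∈ S} L_s^* L_s = Id`. -/
structure OQRW {d : ℕ} (V : AddSubgroup (EuclideanSpace ℝ (Fin d)))
    (𝔥 : Type*) [NormedAddCommGroup 𝔥] [InnerProductSpace ℂ 𝔥] [CompleteSpace 𝔥] where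
  S : Set V
  S_ne : S ≠ {0}
  generates : AddSubmonoid.closure S = ⊤
  L : S → (𝔥 →L[ℂ] 𝔥)
  stochastic : HasSum (fun s : S => adjoint (L s) * L s) 1

section Operators

variable {𝔥 : Type*} [NormedAddCommGroup 𝔥] [InnerProductSpace ℂ 𝔥] [CompleteSpace 𝔥]

/-- The trace of an operator (on a finite-dimensional space, where every operator is
trace class). -/
def tr (A : 𝔥 →L[ℂ] 𝔥) : ℂ := LinearMap.trace ℂ 𝔥 (A : 𝔥 →ₗ[ℂ] 𝔥)

/-- A state on `𝔥`: a positive operator of trace one. -/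
def IsState (ρ : 𝔥 →L[ℂ] 𝔥) : Prop := ρ.IsPositive ∧ tr ρ = 1

/-- Irreducibility of a map `Φ` on the operators on `𝔥` (finite-dimensional): the only orthogonal
projections `P` with `Φ(P 𝓘₁(𝔥) P) ⊆ P 𝓘₁(𝔥) P` are `0` and `Id`. -/
def IsIrreducible (Φ : (𝔥 →L[ℂ] 𝔥) → (𝔥 →L[ℂ] 𝔥)) : Prop :=
  ∀ P : 𝔥 →L[ℂ] 𝔥, IsStarProjection P →
    (∀ X : 𝔥 →L[ℂ] 𝔥, ∃ Y : 𝔥 →L[ℂ] 𝔥, Φ (P * X * P) = P * Y * P) → P = 0 ∨ P = 1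

variable {d : ℕ} {V : AddSubgroup (EuclideanSpace ℝ (Fin d))}

/-- The auxiliary map `𝔏(ρ) = ∑_{s ∈ S} L_s ρ L_s^*`. -/
def OQRW.aux (W : OQRW V 𝔥) (ρ : 𝔥 →L[ℂ] 𝔥) : 𝔥 →L[ℂ] 𝔥 :=
  ∑' s : W.S, W.L s * ρ * adjoint (W.L s)

/-- The vector `∑_{s ∈ S} Tr(L_s ρ L_s^*) s` of `ℝ^d`. -/
def OQRW.drift (W : OQRW V 𝔥) (ρ : 𝔥 →L[ℂ] 𝔥) : EuclideanSpace ℝ (Fin d) :=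
  ∑' s : W.S, (tr (W.L s * ρ * adjoint (W.L s))).re • ((s : V) : EuclideanSpace ℝ (Fin d))

open Classical in
/-- The unnormalised state after the displacement `v`: `L_v A L_v^*` if `v ∈ S`, else `0`. -/
def OQRW.step (W : OQRW V 𝔥) (v : V) (A : 𝔥 →L[ℂ] 𝔥) : 𝔥 →L[ℂ] 𝔥 :=
  if h : v ∈ W.S then W.L ⟨v, h⟩ * A * adjoint (W.L ⟨v, h⟩) else 0

/-- A state `∑_{i ∈ V} ρ(i) ⊗ |i⟩⟨i|` on `𝔥 ⊗ ℂ^V` (`𝔥` finite-dimensional), given by its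
diagonal blocks `ρ(i)`: these are positive and their traces sum to one. -/
structure DiagState {d : ℕ} (V : AddSubgroup (EuclideanSpace ℝ (Fin d)))
    (𝔥 : Type*) [NormedAddCommGroup 𝔥] [InnerProductSpace ℂ 𝔥] [CompleteSpace 𝔥] where
  block : V → (𝔥 →L[ℂ] 𝔥)
  isPositive : ∀ i, (block i).IsPositive
  hasSum_tr : HasSum (fun i => tr (block i)) 1

/-- `L_{s_p} ⋯ L_{s_1} ρ(x_0) L_{s_1}^* ⋯ L_{s_p}^*` where `s_k = x_k - x_{k-1}`, and `0` if some
`s_k` is not in `S`. -/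
def OQRW.pathState (W : OQRW V 𝔥) (ρ : DiagState V 𝔥) (x : ℕ → V) : ℕ → (𝔥 →L[ℂ] 𝔥)
  | 0 => ρ.block (x 0)
  | p + 1 => W.step (x (p + 1) - x p) (W.pathState ρ x p)

/-- `P` is the law on `V^ℕ` of the positions measured along the walk started in `ρ`:
`P(X_0 = x_0, …, X_p = x_p) = Tr(L_{s_p} ⋯ L_{s_1} ρ(x_0) L_{s_1}^* ⋯ L_{s_p}^*)` if all the
increments `s_k = x_k - x_{k-1}` are in `S`, and `0` otherwise. -/
def OQRW.IsTrajectoryLaw (W : OQRW V 𝔥) (ρ : DiagState V 𝔥) (P : Measure (ℕ → V)) : Prop :=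
  IsProbabilityMeasure P ∧ ∀ (x : ℕ → V) (p : ℕ),
    P {ω | ∀ k ≤ p, ω k = x k} = ENNReal.ofReal (tr (W.pathState ρ x p)).re

end Operators

/-! Existence and uniqueness of the trajectory law. -/

section Existence

variable {𝔥 : Type*} [NormedAddCommGroup 𝔥] [InnerProductSpace ℂ 𝔥] [CompleteSpace 𝔥]
  {d : ℕ} {V : AddSubgroup (EuclideanSpace ℝ (Fin d))}

theorem countable_of_discrete [DiscreteTopology V] : Countable V :=
  TopologicalSpace.separableSpace_iff_countable.1 inferInstance

theorem OQRW.step_isPositive (W : OQRW V 𝔥) (v : V) {A : 𝔥 →L[ℂ] 𝔥} (hA : A.IsPositive) :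
    (W.step v A).IsPositive := by
  unfold OQRW.step
  split_ifs with h
  · have := hA.conj_adjoint (W.L ⟨v, h⟩)
    exact this
  · exact ContinuousLinearMap.isPositive_zero

theorem OQRW.pathState_isPositive (W : OQRW V 𝔥) (ρ : DiagState V 𝔥) (x : ℕ → V) (p : ℕ) :
    (W.pathState ρ x p).IsPositive := by
  induction p with
  | zero => exact ρ.isPositive _
  | succ p ih => exact W.step_isPositive _ ih

theorem OQRW.pathState_congr (W : OQRW V 𝔥) (ρ : DiagState V 𝔥) {x y : ℕ → V} {p : ℕ}
    (h : ∀ k ≤ p, x k = y k) : W.pathState ρ x p = W.pathState ρ y p := by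
  induction p with
  | zero => simp [OQRW.pathState, h 0 le_rfl]
  | succ p ih =>
    simp only [OQRW.pathState]
    rw [ih fun k hk => h k (by omega), h (p + 1) le_rfl, h p (by omega)]

variable [FiniteDimensional ℂ 𝔥]

theorem tr_re_nonneg {A : 𝔥 →L[ℂ] 𝔥} (hA : A.IsPositive) : 0 ≤ (tr A).re := by
  have h : (A : 𝔥 →ₗ[ℂ] 𝔥).IsPositive := (isPositive_toLinearMap_iff A).2 hA
  exact (Complex.le_def.1 h.trace_nonneg).1

/-- The trace as a continuous linear map. -/
def trCLM : (𝔥 →L[ℂ] 𝔥) →L[ℂ] ℂ :=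
  LinearMap.toContinuousLinearMap
    ((LinearMap.trace ℂ 𝔥) ∘ₗ (ContinuousLinearMap.coeLM ℂ : (𝔥 →L[ℂ] 𝔥) →ₗ[ℂ] 𝔥 →ₗ[ℂ] 𝔥))

theorem trCLM_apply (A : 𝔥 →L[ℂ] 𝔥) : trCLM A = tr A := rfl

theorem tr_mul_comm (A B : 𝔥 →L[ℂ] 𝔥) : tr (A * B) = tr (B * A) :=
  LinearMap.trace_mul_comm ℂ (A : 𝔥 →ₗ[ℂ] 𝔥) (B : 𝔥 →ₗ[ℂ] 𝔥)

theorem OQRW.hasSum_step (W : OQRW V 𝔥) (A : 𝔥 →L[ℂ] 𝔥) :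
    HasSum (fun v : V => (tr (W.step v A)).re) (tr A).re := by
  have h1 : HasSum (fun s : W.S => tr (W.L s * A * adjoint (W.L s))) (tr A) := by
    have := trCLM.hasSum (W.stochastic.mul_right A)
    simp only [one_mul, trCLM_apply] at this
    convert this using 2 with s
    rw [tr_mul_comm, mul_assoc]
  have h2 : HasSum (fun s : W.S => (tr (W.step (s : V) A)).re) (tr A).re := by
    have := Complex.hasSum_re h1
    convert this using 2 with s
    simp [OQRW.step]
  refine (Function.Injective.hasSum_iff Subtype.val_injective ?_).1 h2
  intro v hv
  have : v ∉ W.S := by simpa using hv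
  simp [OQRW.step, this, tr]

/-- The conditional law of the next position, given the positions up to time `n`. -/
def OQRW.nextLaw (W : OQRW V 𝔥) (ρ : DiagState V 𝔥) (x : ℕ → V) (n : ℕ) : Measure V :=
  if (tr (W.pathState ρ x n)).re = 0 then Measure.dirac 0 else
    Measure.sum fun j : V => ENNReal.ofReal
      ((tr (W.step (j - x n) (W.pathState ρ x n))).re / (tr (W.pathState ρ x n)).re) •
        Measure.dirac j

theorem OQRW.nextLaw_isProb (W : OQRW V 𝔥) (ρ : DiagState V 𝔥) (x : ℕ → V) (n : ℕ) :
    IsProbabilityMeasure (W.nextLaw ρ x n) := by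
  unfold OQRW.nextLaw
  split_ifs with h
  · infer_instance
  · refine ⟨?_⟩
    rw [Measure.sum_apply _ MeasurableSet.univ]
    simp only [Measure.smul_apply, measure_univ, smul_eq_mul, mul_one]
    have hs : HasSum (fun j : V => (tr (W.step (j - x n) (W.pathState ρ x n))).re /
        (tr (W.pathState ρ x n)).re) 1 := by
      have := ((Equiv.subRight (x n)).hasSum_iff.2
        (W.hasSum_step (W.pathState ρ x n))).div_const (tr (W.pathState ρ x n)).re
      rw [div_self h] at this
      exact this
    rw [← ENNReal.ofReal_tsum_of_nonneg _ hs.summable, hs.tsum_eq, ENNReal.ofReal_one]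
    intro j
    exact div_nonneg (tr_re_nonneg (W.step_isPositive _ (W.pathState_isPositive ρ x n)))
      (tr_re_nonneg (W.pathState_isPositive ρ x n))

theorem OQRW.mul_nextLaw_singleton (W : OQRW V 𝔥) (ρ : DiagState V 𝔥) (x : ℕ → V) (n : ℕ) :
    ENNReal.ofReal (tr (W.pathState ρ x n)).re * W.nextLaw ρ x n {x (n + 1)} =
      ENNReal.ofReal (tr (W.pathState ρ x (n + 1))).re := by
  have h0 := tr_re_nonneg (W.pathState_isPositive ρ x n)
  have hpos : ∀ v, 0 ≤ (tr (W.step v (W.pathState ρ x n))).re := fun v =>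
    tr_re_nonneg (W.step_isPositive v (W.pathState_isPositive ρ x n))
  unfold OQRW.nextLaw
  split_ifs with h
  · have hz : (tr (W.pathState ρ x (n + 1))).re = 0 := by
      have hs := W.hasSum_step (W.pathState ρ x n)
      rw [h] at hs
      have := (hasSum_zero_iff_of_nonneg hpos).1 hs
      exact congrFun this (x (n + 1) - x n)
    rw [h, hz]; simp
  · rw [Measure.sum_apply _ (measurableSet_singleton _)]
    rw [tsum_eq_single (x (n + 1))]
    · simp only [Measure.smul_apply, smul_eq_mul]
      rw [Measure.dirac_apply_of_mem (by simp), mul_one, ← ENNReal.ofReal_mul h0,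
        mul_div_cancel₀ _ h]
      rfl
    · intro j hj
      simp [hj]

/-- The law of the initial position. -/
def initialLaw (ρ : DiagState V 𝔥) : Measure V :=
  Measure.sum fun i : V => ENNReal.ofReal (tr (ρ.block i)).re • Measure.dirac i

theorem initialLaw_isProb (ρ : DiagState V 𝔥) : IsProbabilityMeasure (initialLaw ρ) := by
  refine ⟨?_⟩
  unfold initialLaw
  rw [Measure.sum_apply _ MeasurableSet.univ]
  simp only [Measure.smul_apply, measure_univ, smul_eq_mul, mul_one]
  have hs := Complex.hasSum_re ρ.hasSum_tr
  rw [← ENNReal.ofReal_tsum_of_nonneg (fun i => tr_re_nonneg (ρ.isPositive i)) hs.summable,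
    hs.tsum_eq]
  simp

theorem initialLaw_singleton (ρ : DiagState V 𝔥) (i : V) :
    initialLaw ρ {i} = ENNReal.ofReal (tr (ρ.block i)).re := by
  unfold initialLaw
  rw [Measure.sum_apply _ (measurableSet_singleton _), tsum_eq_single i]
  · simp
  · intro j hj
    simp [hj]

/-- A finite path, prolonged by `0`. -/
def extendPath {n : ℕ} (x : (i : Finset.Iic n) → V) (k : ℕ) : V :=
  if h : k ≤ n then x ⟨k, Finset.mem_Iic.2 h⟩ else 0

/-- The transition kernels. -/
def OQRW.kernel [Countable V] (W : OQRW V 𝔥) (ρ : DiagState V 𝔥) (n : ℕ) :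
    Kernel ((i : Finset.Iic n) → V) V where
  toFun x := W.nextLaw ρ (extendPath x) n
  measurable' := measurable_of_countable _

instance [Countable V] (W : OQRW V 𝔥) (ρ : DiagState V 𝔥) (n : ℕ) :
    IsMarkovKernel (W.kernel ρ n) :=
  ⟨fun _ => W.nextLaw_isProb ρ _ n⟩

theorem cylinder_eq (x : ℕ → V) (n : ℕ) :
    {ω : ℕ → V | ∀ k ≤ n, ω k = x k} =
      (Preorder.frestrictLe (π := fun _ => V) n) ⁻¹' {Preorder.frestrictLe n x} := by
  ext ω
  simp only [Set.mem_ofPred_eq, Set.mem_preimage, Set.mem_singleton_iff]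
  constructor
  · intro h
    ext ⟨k, hk⟩ : 1
    exact h k (Finset.mem_Iic.1 hk)
  · intro h k hk
    exact congrFun h ⟨k, Finset.mem_Iic.2 hk⟩

theorem OQRW.exists_trajectoryLaw [Countable V] (W : OQRW V 𝔥) (ρ : DiagState V 𝔥) :
    ∃ P : Measure (ℕ → V), W.IsTrajectoryLaw ρ P := by
  have := initialLaw_isProb ρ
  let κ : (n : ℕ) → Kernel ((i : Finset.Iic n) → (fun _ : ℕ => V) i) V := fun n => W.kernel ρ n
  have : ∀ n, IsMarkovKernel (κ n) := fun n =>
    inferInstanceAs (IsMarkovKernel (W.kernel ρ n))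
  let P : Measure (ℕ → V) := Kernel.trajMeasure (X := fun _ => V) (initialLaw ρ) κ
  have hP : IsProbabilityMeasure P :=
    inferInstanceAs (IsProbabilityMeasure (Kernel.trajMeasure (X := fun _ => V) (initialLaw ρ) κ))
  refine ⟨P, hP, fun x p => ?_⟩
  induction p with
  | zero =>
    have hμ : P.map (Preorder.frestrictLe (π := fun _ => V) 0) =
        (initialLaw ρ).map
          (MeasurableEquiv.piUnique (fun i : Finset.Iic 0 => (fun _ : ℕ => V) i)).symm := by
      change (Kernel.trajMeasure (X := fun _ => V) (initialLaw ρ) κ).map _ = _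
      rw [Kernel.trajMeasure, Measure.map_comp _ _ (by fun_prop), Kernel.traj_map_frestrictLe,
        Kernel.partialTraj_self, Measure.id_comp]
    rw [cylinder_eq, ← Measure.map_apply (by fun_prop) (measurableSet_singleton _), hμ,
      Measure.map_apply (by fun_prop) (measurableSet_singleton _)]
    have : (MeasurableEquiv.piUnique (fun i : Finset.Iic 0 => (fun _ : ℕ => V) i)).symm ⁻¹'
        {Preorder.frestrictLe (π := fun _ => V) 0 x} = {x 0} := by
      ext v
      simp only [Set.mem_preimage, Set.mem_singleton_iff]
      rw [MeasurableEquiv.symm_apply_eq]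
      rfl
    rw [this, initialLaw_singleton]
    rfl
  | succ n ih =>
    have key := Kernel.map_frestrictLe_trajMeasure_compProd_eq_map_trajMeasure
      (X := fun _ => V) (μ₀ := initialLaw ρ) (κ := κ) (a := n)
    have h1 : {ω : ℕ → V | ∀ k ≤ n + 1, ω k = x k} =
        (fun ω : ℕ → V => (Preorder.frestrictLe (π := fun _ => V) n ω, ω (n + 1))) ⁻¹'
          ({Preorder.frestrictLe n x} ×ˢ {x (n + 1)}) := by
      have := cylinder_eq x n
      ext ω
      have h2 := Set.ext_iff.1 this ω
      simp only [Set.mem_ofPred_eq, Set.mem_preimage, Set.mem_singleton_iff, Set.mem_prod] at h2 ⊢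
      rw [← h2]
      constructor
      · exact fun h => ⟨fun k hk => h k (by omega), h _ le_rfl⟩
      · rintro ⟨h, h'⟩ k hk
        rcases Nat.lt_or_ge n k with hk' | hk'
        · obtain rfl : k = n + 1 := by omega
          exact h'
        · exact h k hk'
    rw [h1, ← Measure.map_apply (by fun_prop)
      ((measurableSet_singleton _).prod (measurableSet_singleton _))]
    change (Measure.map _ (Kernel.trajMeasure (X := fun _ => V) (initialLaw ρ) κ)) _ = _
    rw [← key, Measure.compProd_apply_prod (measurableSet_singleton _) (measurableSet_singleton _),
      lintegral_singleton, Measure.map_apply (by fun_prop) (measurableSet_singleton _),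
      ← cylinder_eq]
    change κ n _ _ * P _ = _
    rw [ih, mul_comm, ← W.mul_nextLaw_singleton ρ x n]
    have hx : ∀ k ≤ n, extendPath (Preorder.frestrictLe (π := fun _ => V) n x) k = x k := by
      intro k hk
      simp [extendPath, hk]
    have hn : W.nextLaw ρ (extendPath (Preorder.frestrictLe (π := fun _ => V) n x)) n =
        W.nextLaw ρ x n := by
      unfold OQRW.nextLaw
      rw [W.pathState_congr ρ hx, hx n le_rfl]
    rw [← hn]
    rfl

theorem OQRW.trajectoryLaw_unique [Countable V] (W : OQRW V 𝔥) (ρ : DiagState V 𝔥)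
    {P Q : Measure (ℕ → V)} (hP : W.IsTrajectoryLaw ρ P) (hQ : W.IsTrajectoryLaw ρ Q) :
    P = Q := by
  have := hP.1
  have := hQ.1
  have hmap : ∀ n, P.map (Preorder.frestrictLe (π := fun _ => V) n) =
      Q.map (Preorder.frestrictLe (π := fun _ => V) n) := by
    intro n
    refine Measure.ext_of_singleton fun a => ?_
    have ha : a = Preorder.frestrictLe (π := fun _ => V) n (extendPath a) := by
      ext ⟨k, hk⟩ : 1
      have : k ≤ n := Finset.mem_Iic.1 hk
      simp [extendPath, this]
    rw [ha, Measure.map_apply (by fun_prop) (measurableSet_singleton _),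
      Measure.map_apply (by fun_prop) (measurableSet_singleton _), ← cylinder_eq, hP.2, hQ.2]
  have hproj : ∀ I : Finset ℕ, P.map (I.restrict (π := fun _ => V)) =
      Q.map (I.restrict (π := fun _ => V)) := by
    intro I
    have hI := I.subset_Iic_sup_id
    have h := congrArg (Measure.map (Finset.restrict₂ (π := fun _ => V) hI)) (hmap (I.sup id))
    rw [Measure.map_map (by fun_prop) (by fun_prop),
      Measure.map_map (by fun_prop) (by fun_prop)] at h
    exact h
  exact IsProjectiveLimit.unique (P := fun I => Q.map (I.restrict (π := fun _ => V)))
    (fun I => hproj I) (fun I => rfl)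

/-- The probability `ℙ_ρ` on `V^ℕ`: the unique measure whose cylinder probabilities are those of
`OQRW.IsTrajectoryLaw`. The position process is the process of coordinates. -/
def OQRW.law [DiscreteTopology V] (W : OQRW V 𝔥) (ρ : DiagState V 𝔥) : Measure (ℕ → V) :=
  haveI : Countable V := countable_of_discrete
  Classical.choose (W.exists_trajectoryLaw ρ)

theorem OQRW.law_spec [DiscreteTopology V] (W : OQRW V 𝔥) (ρ : DiagState V 𝔥) :
    W.IsTrajectoryLaw ρ (W.law ρ) :=
  have : Countable V := countable_of_discrete
  Classical.choose_spec (W.exists_trajectoryLaw ρ)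

end Existence

end OpenQuantumWalk

end

/-!
The proof is elementary: the perturbation theory of the leading eigenvalue of the tilted map
`𝔏_u(ρ) = ∑_s e^{⟨u, s⟩} L_s ρ L_s^*` is replaced by a Poisson equation.

*Fixed points.* If `A` is self-adjoint with `𝔏^* A = A` and `c` is its smallest eigenvalue, the
kernel of `A - c ≥ 0` is nonzero and invariant under every `L_s`, so irreducibility forces `A = c`
(`OQRW.exists_eq_smul_one`). Hence the range of `1 - 𝔏^*` has codimension one. An invariant state
`ρ` exists as a limit of Birkhoff averages (`OQRW.exists_invariant_state`). The range of `1 - 𝔏^*`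
lies in the kernel of `A ↦ Tr(A ρ)`, so the two coincide (`OQRW.exists_poisson`). This gives the
uniqueness of `ρ`, and for every vector `u` a self-adjoint `B` with
`B - 𝔏^* B = ∑_s ⟨u, s⟩ L_s^* L_s - ⟨u, m⟩`.

*Exponential moments.* For small `t ≥ 0` the operator `1 + t B` is positive, and a second-order
expansion gives `𝔏_{tu}^* (1 + t B) ≤ e^{t⟨u, m⟩ + C t²} (1 + t B)`
(`OQRW.exists_tilted_subeigenvector`). The expectation of `e^{t⟨u, X_p - X_0⟩}` is a sum over paths
in which each step acts by `𝔏_{tu}^*` (`OQRW.tiltedSum_succ`), so it is at most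
`4 e^{p (t⟨u, m⟩ + C t²)}`.

*Concentration.* Markov's inequality with `t` small bounds the probability that `X_p - X_0` exceeds
its mean rate along `u` (`OQRW.exists_chernoff`). Taking for `u` the vectors `± e_i` gives the
exponential convergence, and the Borel-Cantelli lemma the almost sure one.
-/

noncomputable section

namespace OpenQuantumWalk

/-! ### Positive operators and the trace -/

section Trace

variable {𝔥 : Type*} [NormedAddCommGroup 𝔥] [InnerProductSpace ℂ 𝔥] [CompleteSpace 𝔥]

theorem mul_mul_adjoint_nonneg {A : 𝔥 →L[ℂ] 𝔥} (hA : 0 ≤ A) (T : 𝔥 →L[ℂ] 𝔥) :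
    0 ≤ T * A * adjoint T := by
  rw [← star_eq_adjoint]
  exact star_right_conjugate_nonneg hA T

theorem re_inner_apply_nonneg {A : 𝔥 →L[ℂ] 𝔥} (hA : 0 ≤ A) (v : 𝔥) : 0 ≤ (⟪A v, v⟫_ℂ).re :=
  ((nonneg_iff_isPositive A).1 hA).re_inner_nonneg_left v

/-- Cauchy-Schwarz for the form of a positive operator: an isotropic vector is in the kernel. -/
theorem apply_eq_zero_of_re_inner_eq_zero {A : 𝔥 →L[ℂ] 𝔥} (hA : 0 ≤ A) {v : 𝔥}
    (hv : (⟪A v, v⟫_ℂ).re = 0) : A v = 0 := by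
  obtain ⟨C, rfl⟩ := CStarAlgebra.nonneg_iff_eq_star_mul_self.1 hA
  have h : C v = 0 := by
    change (⟪adjoint C (C v), v⟫_ℂ).re = 0 at hv
    rw [adjoint_inner_left, inner_self_eq_norm_sq_to_K] at hv
    have : ‖C v‖ ^ 2 = 0 := by exact_mod_cast hv
    simpa using this
  change star C (C v) = 0
  rw [h, map_zero]

theorem nonneg_of_re_inner_nonneg {A : 𝔥 →L[ℂ] 𝔥} (hA : IsSelfAdjoint A)
    (h : ∀ v, 0 ≤ (⟪A v, v⟫_ℂ).re) : 0 ≤ A :=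
  (nonneg_iff_isPositive A).2 (isPositive_def'.2 ⟨hA, h⟩)

theorem sub_smul_one_apply (A : 𝔥 →L[ℂ] 𝔥) (c : ℝ) (v : 𝔥) :
    (A - c • (1 : 𝔥 →L[ℂ] 𝔥)) v = A v - c • v := rfl

theorem isSelfAdjoint_smul_one (c : ℝ) : IsSelfAdjoint (c • (1 : 𝔥 →L[ℂ] 𝔥)) :=
  (IsSelfAdjoint.all c).smul (IsSelfAdjoint.one _)

theorem norm_adjoint_mul_mul_le (T A : 𝔥 →L[ℂ] 𝔥) : ‖adjoint T * A * T‖ ≤ ‖T‖ ^ 2 * ‖A‖ := by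
  calc ‖adjoint T * A * T‖ ≤ ‖adjoint T‖ * ‖A‖ * ‖T‖ :=
        (norm_mul_le _ _).trans (by gcongr; exact norm_mul_le _ _)
    _ = ‖T‖ ^ 2 * ‖A‖ := by rw [LinearIsometryEquiv.norm_map]; ring

theorem norm_mul_mul_adjoint_le (T A : 𝔥 →L[ℂ] 𝔥) : ‖T * A * adjoint T‖ ≤ ‖T‖ ^ 2 * ‖A‖ := by
  have := norm_adjoint_mul_mul_le (adjoint T) A
  rwa [adjoint_adjoint, LinearIsometryEquiv.norm_map] at this

/-- A self-adjoint operator of norm at most `r` lies below `r • 1`. -/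
theorem le_smul_one_of_norm_le {A : 𝔥 →L[ℂ] 𝔥} (hA : IsSelfAdjoint A) {r : ℝ} (hr : ‖A‖ ≤ r) :
    A ≤ r • (1 : 𝔥 →L[ℂ] 𝔥) := by
  calc A ≤ ‖A‖ • (1 : 𝔥 →L[ℂ] 𝔥) := by
        simpa [Algebra.algebraMap_eq_smul_one] using hA.le_algebraMap_norm_self
    _ ≤ r • (1 : 𝔥 →L[ℂ] 𝔥) := smul_le_smul_of_nonneg_right hr zero_le_one

variable [FiniteDimensional ℂ 𝔥]

theorem tr_re_mul_nonneg {A B : 𝔥 →L[ℂ] 𝔥} (hA : 0 ≤ A) (hB : 0 ≤ B) : 0 ≤ (tr (A * B)).re := by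
  obtain ⟨C, rfl⟩ := CStarAlgebra.nonneg_iff_eq_star_mul_self.1 hA
  rw [mul_assoc, tr_mul_comm]
  exact tr_re_nonneg ((nonneg_iff_isPositive _).1 (mul_mul_adjoint_nonneg hB C))

theorem tr_re_mul_le_mul {A A' B : 𝔥 →L[ℂ] 𝔥} (hA : A ≤ A') (hB : 0 ≤ B) :
    (tr (A * B)).re ≤ (tr (A' * B)).re := by
  have := tr_re_mul_nonneg (sub_nonneg.2 hA) hB
  rw [sub_mul, ← trCLM_apply, map_sub, Complex.sub_re] at this
  simpa [trCLM_apply] using this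

theorem re_inner_real_smul_self (r : ℝ) (v : 𝔥) : (⟪r • v, v⟫_ℂ).re = ‖v‖ ^ 2 * r := by
  rw [RCLike.real_smul_eq_coe_smul (K := ℂ), inner_smul_left, inner_self_eq_norm_sq_to_K]
  simp [← Complex.ofReal_pow, mul_comm]

/-- The quadratic form of a positive operator at a unit vector is one diagonal entry in an
orthonormal basis, so it is at most the trace. -/
theorem re_inner_le_tr {A : 𝔥 →L[ℂ] 𝔥} (hA : 0 ≤ A) {v : 𝔥} (hv : ‖v‖ = 1) :
    (⟪A v, v⟫_ℂ).re ≤ (tr A).re := by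
  have ho : Orthonormal ℂ ((↑) : ({v} : Set 𝔥) → 𝔥) := by
    refine ⟨fun i => ?_, fun i j hij => absurd (Subsingleton.elim i j) hij⟩
    rw [i.2, hv]
  obtain ⟨w, b, hw, hb⟩ := ho.exists_orthonormalBasis_extension
  have hvw : v ∈ w := hw rfl
  have htr : (tr A).re = ∑ i, (⟪A (b i), b i⟫_ℂ).re := by
    unfold tr
    rw [LinearMap.trace_eq_sum_inner _ b, Complex.re_sum]
    refine Finset.sum_congr rfl fun i _ => ?_
    rw [← inner_conj_symm, Complex.conj_re]
    rfl
  rw [htr]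
  have := Finset.single_le_sum (f := fun i => (⟪A (b i), b i⟫_ℂ).re)
    (fun i _ => re_inner_apply_nonneg hA (b i)) (Finset.mem_univ (⟨v, hvw⟩ : w))
  simpa [hb] using this

theorem norm_le_tr {A : 𝔥 →L[ℂ] 𝔥} (hA : 0 ≤ A) : ‖A‖ ≤ (tr A).re := by
  have h0 : 0 ≤ (tr A).re := tr_re_nonneg ((nonneg_iff_isPositive A).1 hA)
  rw [CStarAlgebra.norm_le_iff_le_algebraMap A h0 hA, Algebra.algebraMap_eq_smul_one,
    ← sub_nonneg]
  refine nonneg_of_re_inner_nonneg ((isSelfAdjoint_smul_one _).sub (IsSelfAdjoint.of_nonneg hA))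
    fun v => ?_
  rcases eq_or_ne v 0 with rfl | hv
  · rw [inner_zero_right, Complex.zero_re]
  have h1 := re_inner_le_tr hA (norm_smul_inv_norm (𝕜 := ℂ) hv)
  have h2 : (⟪A (((‖v‖ : ℂ)⁻¹) • v), ((‖v‖ : ℂ)⁻¹) • v⟫_ℂ).re = (‖v‖ ^ 2)⁻¹ * (⟪A v, v⟫_ℂ).re := by
    rw [map_smul, inner_smul_left, inner_smul_right, ← mul_assoc, map_inv₀, Complex.conj_ofReal,
      ← Complex.ofReal_inv, ← Complex.ofReal_mul, Complex.re_ofReal_mul]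
    congr 1
    rw [← mul_inv, sq]
  have hv2 : 0 < ‖v‖ ^ 2 := by positivity
  have h3 : (⟪A v, v⟫_ℂ).re ≤ ‖v‖ ^ 2 * (tr A).re := by
    rw [← inv_mul_le_iff₀ hv2, ← h2]; exact h1
  have h4 : (⟪(tr A).re • v, v⟫_ℂ).re = ‖v‖ ^ 2 * (tr A).re := by
    rw [re_inner_real_smul_self]
  change 0 ≤ (⟪(tr A).re • v - A v, v⟫_ℂ).re
  rw [inner_sub_left, Complex.sub_re, h4]
  linarith

/-- The trace pairing is nondegenerate. -/
theorem eq_of_tr_mul_eq {A B : 𝔥 →L[ℂ] 𝔥} (h : ∀ X, tr (X * A) = tr (X * B)) : A = B := by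
  have h0 : tr (star (A - B) * (A - B)) = 0 := by
    rw [mul_sub, ← trCLM_apply, map_sub, trCLM_apply, trCLM_apply, h, sub_self]
  have h1 : star (A - B) * (A - B) = 0 := by
    have := norm_le_tr (star_mul_self_nonneg (A - B))
    rw [h0, Complex.zero_re] at this
    exact norm_le_zero_iff.1 this
  exact sub_eq_zero.1 ((CStarRing.star_mul_self_eq_zero_iff _).1 h1)

/-- A self-adjoint operator minus its smallest eigenvalue is positive with a nonzero kernel. -/
theorem exists_sub_smul_one_nonneg [Nontrivial 𝔥] {A : 𝔥 →L[ℂ] 𝔥} (hA : IsSelfAdjoint A) :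
    ∃ c : ℝ, 0 ≤ A - c • (1 : 𝔥 →L[ℂ] 𝔥) ∧ ∃ v ≠ 0, (A - c • (1 : 𝔥 →L[ℂ] 𝔥)) v = 0 := by
  have hs : ((A : 𝔥 →ₗ[ℂ] 𝔥)).IsSymmetric := hA.isSymmetric
  have hc := hs.hasEigenvalue_iInf_of_finiteDimensional
  set c : ℝ := ⨅ x : { x : 𝔥 // x ≠ 0 }, RCLike.re ⟪(A : 𝔥 →ₗ[ℂ] 𝔥) x, x⟫_ℂ / ‖(x : 𝔥)‖ ^ 2
    with hcdef
  obtain ⟨v, hv⟩ := hc.exists_hasEigenvector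
  have hv1 : A v = (c : ℂ) • v := hv.apply_eq_smul
  refine ⟨c, nonneg_of_re_inner_nonneg (hA.sub (isSelfAdjoint_smul_one c)) fun w => ?_,
    v, hv.2, ?_⟩
  · rw [sub_smul_one_apply, inner_sub_left, Complex.sub_re, re_inner_real_smul_self, sub_nonneg]
    rcases eq_or_ne w 0 with rfl | hw
    · simp
    have hbdd : BddBelow (Set.range fun x : { x : 𝔥 // x ≠ 0 } =>
        RCLike.re ⟪(A : 𝔥 →ₗ[ℂ] 𝔥) x, x⟫_ℂ / ‖(x : 𝔥)‖ ^ 2) := by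
      refine ⟨-‖A‖, ?_⟩
      rintro _ ⟨⟨x, hx⟩, rfl⟩
      have hx2 : 0 < ‖x‖ ^ 2 := by positivity
      have h1 : |RCLike.re ⟪A x, x⟫_ℂ| ≤ ‖A‖ * ‖x‖ ^ 2 := by
        calc |RCLike.re ⟪A x, x⟫_ℂ| ≤ ‖A x‖ * ‖x‖ :=
              (RCLike.abs_re_le_norm _).trans (norm_inner_le_norm _ _)
          _ ≤ ‖A‖ * ‖x‖ * ‖x‖ := by gcongr; exact A.le_opNorm x
          _ = ‖A‖ * ‖x‖ ^ 2 := by ring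
      change -‖A‖ ≤ RCLike.re ⟪A x, x⟫_ℂ / ‖x‖ ^ 2
      rw [le_div_iff₀ hx2]
      linarith [(abs_le.1 h1).1]
    have h := ciInf_le hbdd ⟨w, hw⟩
    have hw2 : 0 < ‖w‖ ^ 2 := by positivity
    rw [← hcdef, le_div_iff₀ hw2] at h
    rw [mul_comm]
    exact h
  · rw [sub_smul_one_apply, hv1, RCLike.real_smul_eq_coe_smul (K := ℂ)]
    exact sub_self _

end Trace

/-! ### The auxiliary map and its dual -/

section Dual

variable {𝔥 : Type*} [NormedAddCommGroup 𝔥] [InnerProductSpace ℂ 𝔥] [CompleteSpace 𝔥]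
  {d : ℕ} {V : AddSubgroup (EuclideanSpace ℝ (Fin d))}

/-- The weighted dual map `A ↦ ∑_s w_s L_s^* A L_s`. For `w = 1` this is the dual `𝔏^*` of the
auxiliary map `𝔏` under the trace pairing; exponential weights give the dual of the tilted map. -/
def OQRW.dualMap (W : OQRW V 𝔥) (w : W.S → ℝ) (A : 𝔥 →L[ℂ] 𝔥) : 𝔥 →L[ℂ] 𝔥 :=
  ∑' s : W.S, w s • (adjoint (W.L s) * A * W.L s)

variable (W : OQRW V 𝔥)

theorem OQRW.norm_dualMap_term_le (w : W.S → ℝ) (A : 𝔥 →L[ℂ] 𝔥) (s : W.S) :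
    ‖w s • (adjoint (W.L s) * A * W.L s)‖ ≤ |w s| * ‖W.L s‖ ^ 2 * ‖A‖ := by
  rw [norm_smul, Real.norm_eq_abs, mul_assoc |w s|]
  exact mul_le_mul_of_nonneg_left (norm_adjoint_mul_mul_le _ _) (abs_nonneg _)

theorem OQRW.hasSum_dualMap {w : W.S → ℝ} (hw : Summable fun s => |w s| * ‖W.L s‖ ^ 2)
    (A : 𝔥 →L[ℂ] 𝔥) :
    HasSum (fun s : W.S => w s • (adjoint (W.L s) * A * W.L s)) (W.dualMap w A) :=
  (Summable.of_norm_bounded (hw.mul_right ‖A‖) (W.norm_dualMap_term_le w A)).hasSum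

theorem OQRW.summable_one_weight (h : Summable fun s : W.S => ‖W.L s‖ ^ 2) :
    Summable fun s : W.S => |(1 : W.S → ℝ) s| * ‖W.L s‖ ^ 2 := by
  simpa using h

theorem OQRW.dualMap_one (A : 𝔥 →L[ℂ] 𝔥) :
    W.dualMap 1 A = ∑' s : W.S, adjoint (W.L s) * A * W.L s := by
  simp [OQRW.dualMap]

theorem OQRW.dualMap_one_one : W.dualMap 1 1 = 1 := by
  rw [W.dualMap_one]
  simpa using W.stochastic.tsum_eq

theorem OQRW.dualMap_star {w : W.S → ℝ} (hw : Summable fun s => |w s| * ‖W.L s‖ ^ 2)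
    (A : 𝔥 →L[ℂ] 𝔥) : W.dualMap w (star A) = star (W.dualMap w A) := by
  refine (W.hasSum_dualMap hw (star A)).unique ((W.hasSum_dualMap hw A).star.congr_fun fun s => ?_)
  simp [← star_eq_adjoint, star_mul, mul_assoc, star_smul]

theorem OQRW.isSelfAdjoint_dualMap {w : W.S → ℝ} (hw : Summable fun s => |w s| * ‖W.L s‖ ^ 2)
    {A : 𝔥 →L[ℂ] 𝔥} (hA : IsSelfAdjoint A) : IsSelfAdjoint (W.dualMap w A) := by
  rw [IsSelfAdjoint, ← W.dualMap_star hw, hA.star_eq]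

theorem OQRW.hasSum_aux (h : Summable fun s : W.S => ‖W.L s‖ ^ 2) (ρ : 𝔥 →L[ℂ] 𝔥) :
    HasSum (fun s : W.S => W.L s * ρ * adjoint (W.L s)) (W.aux ρ) :=
  (Summable.of_norm_bounded (h.mul_right ‖ρ‖) fun _ => norm_mul_mul_adjoint_le _ _).hasSum

/-- The dual map `𝔏^*` as a linear map. -/
def OQRW.dualLin (h : Summable fun s : W.S => ‖W.L s‖ ^ 2) :
    (𝔥 →L[ℂ] 𝔥) →ₗ[ℂ] (𝔥 →L[ℂ] 𝔥) where
  toFun := W.dualMap 1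
  map_add' A B := by
    have hs := W.summable_one_weight h
    refine (W.hasSum_dualMap hs (A + B)).unique ?_
    convert (W.hasSum_dualMap hs A).add (W.hasSum_dualMap hs B) using 2 with s
    simp [mul_add, add_mul]
  map_smul' c A := by
    have hs := W.summable_one_weight h
    refine (W.hasSum_dualMap hs (c • A)).unique ?_
    convert (W.hasSum_dualMap hs A).const_smul c using 2
    · simp
    · rfl

theorem OQRW.dualLin_apply (h : Summable fun s : W.S => ‖W.L s‖ ^ 2) (A : 𝔥 →L[ℂ] 𝔥) :
    W.dualLin h A = W.dualMap 1 A := rfl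

/-- The auxiliary map `𝔏` as a linear map. -/
def OQRW.auxLin (h : Summable fun s : W.S => ‖W.L s‖ ^ 2) :
    (𝔥 →L[ℂ] 𝔥) →ₗ[ℂ] (𝔥 →L[ℂ] 𝔥) where
  toFun := W.aux
  map_add' A B := by
    refine (W.hasSum_aux h (A + B)).unique ?_
    convert (W.hasSum_aux h A).add (W.hasSum_aux h B) using 2 with s
    simp [mul_add, add_mul]
  map_smul' c A := by
    refine (W.hasSum_aux h (c • A)).unique ?_
    convert (W.hasSum_aux h A).const_smul c using 2
    · simp
    · rfl

theorem OQRW.aux_nonneg {ρ : 𝔥 →L[ℂ] 𝔥} (hρ : 0 ≤ ρ) : 0 ≤ W.aux ρ :=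
  tsum_nonneg fun s => mul_mul_adjoint_nonneg hρ (W.L s)

/-- A subspace invariant under all the `L_s` is trivial when `𝔏` is irreducible: the orthogonal
projection `P` onto it satisfies `P L_s P = L_s P`, so that `𝔏(P X P) = P 𝔏(P X P) P`. -/
theorem OQRW.eq_bot_or_eq_top_of_invariant [FiniteDimensional ℂ 𝔥]
    (h : Summable fun s : W.S => ‖W.L s‖ ^ 2)
    (hirr : IsIrreducible W.aux) (K : Submodule ℂ 𝔥)
    (hK : ∀ s, ∀ v ∈ K, W.L s v ∈ K) : K = ⊥ ∨ K = ⊤ := by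
  set P := K.starProjection with hP
  have hPs : IsStarProjection P := isStarProjection_starProjection
  have hL : ∀ s, P * W.L s * P = W.L s * P := by
    intro s
    ext v
    change P (W.L s (P v)) = W.L s (P v)
    exact K.starProjection_eq_self_iff.2 (hK s _ (K.starProjection_apply_mem v))
  have hL' : ∀ s, P * adjoint (W.L s) * P = P * adjoint (W.L s) := by
    intro s
    have := congrArg star (hL s)
    simpa [star_mul, hPs.isSelfAdjoint.star_eq, star_eq_adjoint, mul_assoc] using this
  have key : ∀ X, W.aux (P * X * P) = P * W.aux (P * X * P) * P := by
    intro X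
    refine (W.hasSum_aux h (P * X * P)).unique ?_
    refine (((W.hasSum_aux h (P * X * P)).mul_left P).mul_right P).congr_fun fun s => ?_
    have h1 : W.L s * (P * X * P) * adjoint (W.L s) = (W.L s * P) * X * (P * adjoint (W.L s)) := by
      simp only [mul_assoc]
    rw [h1]
    nth_rewrite 1 [← hL s, ← hL' s]
    simp only [mul_assoc]
  rcases hirr P hPs (fun X => ⟨_, key X⟩) with h0 | h1
  · left
    rw [eq_bot_iff]
    intro v hv
    have := K.starProjection_eq_self_iff.2 hv
    rw [← hP, h0] at this
    exact this.symm
  · right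
    rw [eq_top_iff]
    intro v _
    refine K.starProjection_eq_self_iff.1 ?_
    rw [← hP, h1]
    rfl

/-! ### Fixed points of the dual map, and the invariant state -/

/-- The kernel of a positive fixed point of `𝔏^*` is invariant under every `L_s`. -/
theorem OQRW.apply_L_eq_zero (h : Summable fun s : W.S => ‖W.L s‖ ^ 2)
    {A : 𝔥 →L[ℂ] 𝔥} (hA : 0 ≤ A) (hfix : W.dualMap 1 A = A) {v : 𝔥} (hv : A v = 0) (s : W.S) :
    A (W.L s v) = 0 := by
  have hsum : HasSum (fun s : W.S => (⟪A (W.L s v), W.L s v⟫_ℂ).re) 0 := by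
    have h1 := W.hasSum_dualMap (W.summable_one_weight h) A
    rw [hfix] at h1
    have h2 := ((innerSL ℂ v).comp (ContinuousLinearMap.apply ℂ 𝔥 v)).hasSum h1
    have h3 := Complex.hasSum_re h2
    convert h3 using 1
    · ext t
      have : (((1 : W.S → ℝ) t) • (adjoint (W.L t) * A * W.L t)) v =
          adjoint (W.L t) (A (W.L t v)) := by
        rw [Pi.one_apply, one_smul]; rfl
      change _ = (⟪v, (((1 : W.S → ℝ) t) • (adjoint (W.L t) * A * W.L t)) v⟫_ℂ).re
      rw [this, adjoint_inner_right, ← inner_conj_symm, Complex.conj_re]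
    · change 0 = (⟪v, A v⟫_ℂ).re
      rw [hv, inner_zero_right, Complex.zero_re]
  have := (hasSum_zero_iff_of_nonneg fun t => re_inner_apply_nonneg hA (W.L t v)).1 hsum
  exact apply_eq_zero_of_re_inner_eq_zero hA (congrFun this s)

variable [FiniteDimensional ℂ 𝔥]

theorem OQRW.exists_eq_smul_one_of_isSelfAdjoint [Nontrivial 𝔥]
    (h : Summable fun s : W.S => ‖W.L s‖ ^ 2)
    (hirr : IsIrreducible W.aux) {A : 𝔥 →L[ℂ] 𝔥} (hA : IsSelfAdjoint A)
    (hfix : W.dualMap 1 A = A) : ∃ c : ℝ, A = c • (1 : 𝔥 →L[ℂ] 𝔥) := by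
  obtain ⟨c, hc, v, hv0, hv⟩ := exists_sub_smul_one_nonneg hA
  refine ⟨c, ?_⟩
  have hfix' : W.dualMap 1 (A - c • (1 : 𝔥 →L[ℂ] 𝔥)) = A - c • (1 : 𝔥 →L[ℂ] 𝔥) := by
    have e : c • (1 : 𝔥 →L[ℂ] 𝔥) = (c : ℂ) • (1 : 𝔥 →L[ℂ] 𝔥) := RCLike.real_smul_eq_coe_smul _ _
    rw [e, ← W.dualLin_apply h, map_sub, map_smul, W.dualLin_apply h, W.dualLin_apply h, hfix,
      W.dualMap_one_one]
  rcases W.eq_bot_or_eq_top_of_invariant h hirr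
    (LinearMap.ker (A - c • (1 : 𝔥 →L[ℂ] 𝔥) : 𝔥 →L[ℂ] 𝔥).toLinearMap)
    (fun s w hw => W.apply_L_eq_zero h hc hfix' hw s) with hb | ht
  · exact absurd ((Submodule.eq_bot_iff _).1 hb v hv) hv0
  · refine sub_eq_zero.1 ?_
    ext w
    exact (Submodule.eq_top_iff'.1 ht w : _)

theorem OQRW.exists_eq_smul_one [Nontrivial 𝔥] (h : Summable fun s : W.S => ‖W.L s‖ ^ 2)
    (hirr : IsIrreducible W.aux) {A : 𝔥 →L[ℂ] 𝔥} (hfix : W.dualMap 1 A = A) :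
    ∃ c : ℂ, c • (1 : 𝔥 →L[ℂ] 𝔥) = A := by
  have hs := W.summable_one_weight h
  have hstar : W.dualMap 1 (star A) = star A := by rw [W.dualMap_star hs, hfix]
  have h1 : W.dualMap 1 (A + star A) = A + star A := by
    rw [← W.dualLin_apply h, map_add, W.dualLin_apply h, W.dualLin_apply h, hfix, hstar]
  have h2 : W.dualMap 1 (Complex.I • (A - star A)) = Complex.I • (A - star A) := by
    rw [← W.dualLin_apply h, map_smul, map_sub, W.dualLin_apply h, W.dualLin_apply h, hfix, hstar]
  obtain ⟨a, ha⟩ := W.exists_eq_smul_one_of_isSelfAdjoint h hirr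
    (by simp [IsSelfAdjoint, add_comm]) h1
  obtain ⟨b, hb⟩ := W.exists_eq_smul_one_of_isSelfAdjoint h hirr
    (by simp [IsSelfAdjoint, star_smul, ← smul_neg]) h2
  rw [RCLike.real_smul_eq_coe_smul (K := ℂ)] at ha hb
  refine ⟨(1 / 2 : ℂ) * (a - Complex.I * b), ?_⟩
  have e : A = (1 / 2 : ℂ) • ((A + star A) - Complex.I • (Complex.I • (A - star A))) := by
    rw [smul_smul, Complex.I_mul_I]
    module
  rw [e, ha, hb]
  change _ = (1 / 2 : ℂ) • ((a : ℂ) • (1 : 𝔥 →L[ℂ] 𝔥) - Complex.I • ((b : ℂ) • (1 : 𝔥 →L[ℂ] 𝔥)))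
  module

/-- Duality between `𝔏` and `𝔏^*` under the trace pairing. -/
theorem OQRW.tr_dualMap_mul (h : Summable fun s : W.S => ‖W.L s‖ ^ 2) (A ρ : 𝔥 →L[ℂ] 𝔥) :
    tr (W.dualMap 1 A * ρ) = tr (A * W.aux ρ) := by
  have h1 := trCLM.hasSum ((W.hasSum_dualMap (W.summable_one_weight h) A).mul_right ρ)
  have h2 := trCLM.hasSum ((W.hasSum_aux h ρ).mul_left A)
  refine h1.unique (h2.congr_fun fun s => ?_)
  simp only [trCLM_apply, Pi.one_apply, one_smul]
  rw [mul_assoc, mul_assoc, tr_mul_comm]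
  simp only [mul_assoc]

theorem OQRW.tr_aux (h : Summable fun s : W.S => ‖W.L s‖ ^ 2) (ρ : 𝔥 →L[ℂ] 𝔥) :
    tr (W.aux ρ) = tr ρ := by
  have := W.tr_dualMap_mul h 1 ρ
  rw [W.dualMap_one_one, one_mul, one_mul] at this
  exact this.symm

theorem isCompact_setOf_isState : IsCompact {ρ : 𝔥 →L[ℂ] 𝔥 | IsState ρ} := by
  have : ProperSpace (𝔥 →L[ℂ] 𝔥) := FiniteDimensional.proper ℂ _
  refine Metric.isCompact_of_isClosed_isBounded ?_ ?_
  · have h1 : {ρ : 𝔥 →L[ℂ] 𝔥 | IsState ρ} = {ρ | 0 ≤ ρ} ∩ {ρ | trCLM ρ = 1} := by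
      ext ρ
      simp [IsState, nonneg_iff_isPositive, trCLM_apply]
    rw [h1]
    exact CStarAlgebra.isClosed_nonneg.inter (isClosed_eq trCLM.continuous continuous_const)
  · refine (Metric.isBounded_closedBall (x := 0) (r := 1)).subset fun ρ hρ => ?_
    rw [mem_closedBall_zero_iff]
    have := norm_le_tr ((nonneg_iff_isPositive ρ).2 hρ.1)
    rwa [hρ.2, Complex.one_re] at this

theorem exists_isState [Nontrivial 𝔥] : ∃ ρ : 𝔥 →L[ℂ] 𝔥, IsState ρ := by
  have hn : (0 : ℝ) < Module.finrank ℂ 𝔥 := by exact_mod_cast Module.finrank_pos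
  refine ⟨(Module.finrank ℂ 𝔥 : ℝ)⁻¹ • 1, ?_, ?_⟩
  · exact (nonneg_iff_isPositive _).1 (smul_nonneg (by positivity) zero_le_one)
  · have h1 : tr (1 : 𝔥 →L[ℂ] 𝔥) = Module.finrank ℂ 𝔥 := LinearMap.trace_one ℂ 𝔥
    rw [RCLike.real_smul_eq_coe_smul (K := ℂ), ← trCLM_apply, map_smul, trCLM_apply, h1]
    have : (Module.finrank ℂ 𝔥 : ℂ) ≠ 0 := by exact_mod_cast hn.ne'
    simp [this]

/-- An invariant state is a limit point of the Birkhoff averages of any state. -/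
theorem OQRW.exists_invariant_state [Nontrivial 𝔥] (h : Summable fun s : W.S => ‖W.L s‖ ^ 2) :
    ∃ ρ : 𝔥 →L[ℂ] 𝔥, IsState ρ ∧ W.aux ρ = ρ := by
  obtain ⟨ρ₀, hρ₀⟩ := exists_isState (𝔥 := 𝔥)
  have haux : ∀ ρ, IsState ρ → IsState (W.aux ρ) := fun ρ hρ =>
    ⟨(nonneg_iff_isPositive _).1 (W.aux_nonneg ((nonneg_iff_isPositive _).2 hρ.1)),
      (W.tr_aux h ρ).trans hρ.2⟩
  have hiter : ∀ k, IsState (W.aux^[k] ρ₀) := by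
    intro k
    induction k with
    | zero => exact hρ₀
    | succ k ih => rw [Function.iterate_succ_apply']; exact haux _ ih
  let a : ℕ → (𝔥 →L[ℂ] 𝔥) := fun n => birkhoffAverage ℂ W.aux id (n + 1) ρ₀
  have ha : ∀ n, IsState (a n) := by
    intro n
    have e : a n = ((n + 1 : ℕ) : ℂ)⁻¹ • ∑ k ∈ Finset.range (n + 1), W.aux^[k] ρ₀ := rfl
    have hn : ((n + 1 : ℕ) : ℂ) ≠ 0 := by exact_mod_cast n.succ_ne_zero
    rw [e]
    refine ⟨IsPositive.smul_of_nonneg (isPositive_sum _ fun k _ => (hiter k).1) ?_, ?_⟩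
    · rw [← Complex.ofReal_natCast, ← Complex.ofReal_inv]
      exact Complex.zero_le_real.2 (by positivity)
    · rw [← trCLM_apply, map_smul, map_sum]
      simp only [trCLM_apply, (hiter _).2]
      simpa using inv_mul_cancel₀ hn
  obtain ⟨ρ, hρ, φ, hφ, hlim⟩ := isCompact_setOf_isState.tendsto_subseq ha
  refine ⟨ρ, hρ, ?_⟩
  have hcont : Continuous W.aux := (W.auxLin h).continuous_of_finiteDimensional
  have h1 : Tendsto (fun n => W.aux (a n) - a n) atTop (𝓝 0) := by
    have hb : Bornology.IsBounded (Set.range fun k => id (W.aux^[k] ρ₀)) :=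
      isCompact_setOf_isState.isBounded.subset (by rintro _ ⟨k, rfl⟩; exact hiter k)
    have h2 := (tendsto_birkhoffAverage_apply_sub_birkhoffAverage ℂ hb).comp (tendsto_add_atTop_nat 1)
    refine h2.congr fun n => ?_
    have h3 : W.aux (a n) = birkhoffAverage ℂ W.aux id (n + 1) (W.aux ρ₀) := by
      have h4 := map_birkhoffAverage ℂ ℂ (W.auxLin h) W.aux id (n + 1) ρ₀
      refine h4.trans ?_
      simp only [birkhoffAverage, birkhoffSum]
      congr 1
      refine Finset.sum_congr rfl fun k _ => ?_
      exact (Function.iterate_succ_apply' W.aux k ρ₀).symm.trans (Function.iterate_succ_apply _ _ _)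
    change _ = W.aux (a n) - a n
    rw [h3]
    rfl
  have h5 := h1.comp hφ.tendsto_atTop
  have h6 := ((hcont.tendsto ρ).comp hlim).sub hlim
  exact sub_eq_zero.1 (tendsto_nhds_unique h6 h5)

/-- Solvability of the Poisson equation. The range of `1 - 𝔏^*` is contained in the kernel of
`Tr(· ρ)`, and both have codimension one since the fixed points of `𝔏^*` are the scalars. -/
theorem OQRW.exists_poisson [Nontrivial 𝔥] (h : Summable fun s : W.S => ‖W.L s‖ ^ 2)
    (hirr : IsIrreducible W.aux) {ρ : 𝔥 →L[ℂ] 𝔥} (hρ : IsState ρ) (hinv : W.aux ρ = ρ)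
    {A : 𝔥 →L[ℂ] 𝔥} (hA : tr (A * ρ) = 0) : ∃ B, B - W.dualMap 1 B = A := by
  let T : (𝔥 →L[ℂ] 𝔥) →ₗ[ℂ] (𝔥 →L[ℂ] 𝔥) := LinearMap.id - W.dualLin h
  let f : (𝔥 →L[ℂ] 𝔥) →ₗ[ℂ] ℂ :=
    (trCLM : (𝔥 →L[ℂ] 𝔥) →L[ℂ] ℂ).toLinearMap ∘ₗ LinearMap.mulRight ℂ ρ
  have hf : ∀ X, f X = tr (X * ρ) := fun X => rfl
  have hle : LinearMap.range T ≤ LinearMap.ker f := by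
    rintro _ ⟨X, rfl⟩
    rw [LinearMap.mem_ker]
    change tr ((X - W.dualMap 1 X) * ρ) = 0
    rw [sub_mul, ← trCLM_apply, map_sub, trCLM_apply, trCLM_apply, W.tr_dualMap_mul h, hinv,
      sub_self]
  have hf1 : f 1 = 1 := by rw [hf, one_mul, hρ.2]
  have hsurj : LinearMap.range f = ⊤ :=
    LinearMap.range_eq_top.2 fun c => ⟨c • 1, by rw [map_smul, hf1, smul_eq_mul, mul_one]⟩
  have hkerT : Module.finrank ℂ (LinearMap.ker T) ≤ 1 := by
    have h1T : (1 : 𝔥 →L[ℂ] 𝔥) ∈ LinearMap.ker T :=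
      LinearMap.mem_ker.2 (sub_eq_zero.2 W.dualMap_one_one.symm)
    refine finrank_le_one ⟨1, h1T⟩ ?_
    rintro ⟨X, hX⟩
    obtain ⟨c, hc⟩ := W.exists_eq_smul_one h hirr (sub_eq_zero.1 (LinearMap.mem_ker.1 hX)).symm
    exact ⟨c, Subtype.ext hc⟩
  have e1 := LinearMap.finrank_range_add_finrank_ker T
  have e2 := LinearMap.finrank_range_add_finrank_ker f
  rw [hsurj, finrank_top, Module.finrank_self] at e2
  have heq : LinearMap.range T = LinearMap.ker f :=
    Submodule.eq_of_le_of_finrank_le hle (by omega)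
  have hmem : A ∈ LinearMap.range T := by rw [heq, LinearMap.mem_ker, hf, hA]
  exact hmem

theorem OQRW.invariant_state_unique [Nontrivial 𝔥] (h : Summable fun s : W.S => ‖W.L s‖ ^ 2)
    (hirr : IsIrreducible W.aux) {ρ σ : 𝔥 →L[ℂ] 𝔥} (hρ : IsState ρ) (hinv : W.aux ρ = ρ)
    (hσ : IsState σ) (hinv' : W.aux σ = σ) : σ = ρ := by
  refine eq_of_tr_mul_eq fun X => ?_
  have hlin : ∀ τ : 𝔥 →L[ℂ] 𝔥, IsState τ →
      tr ((X - tr (X * ρ) • (1 : 𝔥 →L[ℂ] 𝔥)) * τ) = tr (X * τ) - tr (X * ρ) := by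
    intro τ hτ
    rw [sub_mul, smul_mul_assoc, one_mul, ← trCLM_apply, map_sub, map_smul, trCLM_apply,
      trCLM_apply, hτ.2, smul_eq_mul, mul_one]
  obtain ⟨B, hB⟩ := W.exists_poisson h hirr hρ hinv ((hlin ρ hρ).trans (sub_self _))
  have h1 := hlin σ hσ
  rw [← hB, sub_mul, ← trCLM_apply, map_sub, trCLM_apply, trCLM_apply, W.tr_dualMap_mul h, hinv',
    sub_self] at h1
  exact (sub_eq_zero.1 h1.symm)

end Dual

/-! ### A perturbed eigenvector inequality for the tilted dual map -/

theorem abs_exp_sub_one_le_abs_mul_exp (x : ℝ) : |Real.exp x - 1| ≤ |x| * Real.exp |x| := by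
  have h := Complex.norm_exp_sub_sum_le_norm_mul_exp (x : ℂ) 1
  simp only [Finset.sum_range_one, pow_zero, Nat.factorial_zero, Nat.cast_one, div_one, pow_one,
    Complex.norm_real, Real.norm_eq_abs] at h
  rw [← Real.norm_eq_abs, ← Complex.norm_real]
  push_cast
  exact h

theorem abs_exp_sub_one_sub_le_sq_mul_exp (x : ℝ) :
    |Real.exp x - 1 - x| ≤ |x| ^ 2 * Real.exp |x| := by
  have h := Complex.norm_exp_sub_sum_le_norm_mul_exp (x : ℂ) 2
  simp only [Finset.sum_range_succ, Finset.sum_range_zero, zero_add, pow_zero, Nat.factorial_zero,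
    Nat.cast_one, div_one, pow_one, Nat.factorial_one, Complex.norm_real, Real.norm_eq_abs] at h
  rw [← Real.norm_eq_abs, ← Complex.norm_real, sub_sub]
  push_cast
  exact h

theorem abs_mul_exp_sub_one_le {t a : ℝ} (h0 : 0 ≤ t) (h1 : t ≤ 1) :
    |t * (Real.exp (t * a) - 1)| ≤ t ^ 2 * Real.exp (2 * |a|) := by
  have hta : |t * a| = t * |a| := by rw [abs_mul, abs_of_nonneg h0]
  have hle : t * |a| ≤ |a| := mul_le_of_le_one_left (abs_nonneg a) h1
  have ha : |a| ≤ Real.exp |a| := by linarith [Real.add_one_le_exp |a|]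
  rw [abs_mul, abs_of_nonneg h0]
  calc t * |Real.exp (t * a) - 1| ≤ t * (t * |a| * Real.exp |a|) := by
        refine mul_le_mul_of_nonneg_left ?_ h0
        refine (abs_exp_sub_one_le_abs_mul_exp _).trans ?_
        rw [hta]
        gcongr
    _ = t ^ 2 * (|a| * Real.exp |a|) := by ring
    _ ≤ t ^ 2 * (Real.exp |a| * Real.exp |a|) := by gcongr
    _ = t ^ 2 * Real.exp (2 * |a|) := by rw [← Real.exp_add]; ring_nf

theorem abs_exp_sub_one_sub_mul_le {t a : ℝ} (h0 : 0 ≤ t) (h1 : t ≤ 1) :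
    |Real.exp (t * a) - 1 - t * a| ≤ 2 * t ^ 2 * Real.exp (2 * |a|) := by
  have hta : |t * a| = t * |a| := by rw [abs_mul, abs_of_nonneg h0]
  have hle : t * |a| ≤ |a| := mul_le_of_le_one_left (abs_nonneg a) h1
  have ha : |a| ^ 2 ≤ 2 * Real.exp |a| := by
    linarith [Real.quadratic_le_exp_of_nonneg (abs_nonneg a), abs_nonneg a]
  calc |Real.exp (t * a) - 1 - t * a| ≤ (t * |a|) ^ 2 * Real.exp |a| := by
        refine (abs_exp_sub_one_sub_le_sq_mul_exp _).trans ?_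
        rw [hta]
        gcongr
    _ = t ^ 2 * (|a| ^ 2 * Real.exp |a|) := by ring
    _ ≤ t ^ 2 * (2 * Real.exp |a| * Real.exp |a|) := by gcongr
    _ = 2 * t ^ 2 * Real.exp (2 * |a|) := by
        rw [mul_assoc 2, ← Real.exp_add]; ring_nf

section Tilt

variable {𝔥 : Type*} [NormedAddCommGroup 𝔥] [InnerProductSpace ℂ 𝔥] [CompleteSpace 𝔥]
  {d : ℕ} {V : AddSubgroup (EuclideanSpace ℝ (Fin d))} (W : OQRW V 𝔥)

theorem OQRW.summable_weight_of_abs_le {a w : W.S → ℝ} {C : ℝ}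
    (hE : Summable fun s => Real.exp (2 * |a s|) * ‖W.L s‖ ^ 2)
    (hw : ∀ s, |w s| ≤ C * Real.exp (2 * |a s|)) :
    Summable fun s => |w s| * ‖W.L s‖ ^ 2 := by
  refine Summable.of_nonneg_of_le (fun s => by positivity) (fun s => ?_) (hE.mul_left C)
  rw [← mul_assoc]
  exact mul_le_mul_of_nonneg_right (hw s) (by positivity)

theorem OQRW.summable_weight_self {a : W.S → ℝ}
    (hE : Summable fun s => Real.exp (2 * |a s|) * ‖W.L s‖ ^ 2) :
    Summable fun s => |a s| * ‖W.L s‖ ^ 2 :=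
  W.summable_weight_of_abs_le (C := 1) hE fun s => by
    linarith [Real.add_one_le_exp (2 * |a s|), abs_nonneg (a s)]

theorem OQRW.summable_weight_one {a : W.S → ℝ}
    (hE : Summable fun s => Real.exp (2 * |a s|) * ‖W.L s‖ ^ 2) :
    Summable fun s => |(1 : W.S → ℝ) s| * ‖W.L s‖ ^ 2 :=
  W.summable_weight_of_abs_le (C := 1) hE fun s => by
    simp

theorem OQRW.summable_weight_exp {a : W.S → ℝ} {t : ℝ} (h0 : 0 ≤ t) (h1 : t ≤ 1)
    (hE : Summable fun s => Real.exp (2 * |a s|) * ‖W.L s‖ ^ 2) :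
    Summable fun s => |Real.exp (t * a s)| * ‖W.L s‖ ^ 2 :=
  W.summable_weight_of_abs_le (C := 1) hE fun s => by
    rw [Real.abs_exp, one_mul, Real.exp_le_exp]
    calc t * a s ≤ t * |a s| := mul_le_mul_of_nonneg_left (le_abs_self _) h0
      _ ≤ 1 * |a s| := mul_le_mul_of_nonneg_right h1 (abs_nonneg _)
      _ ≤ 2 * |a s| := by linarith [abs_nonneg (a s)]

/-- First-order expansion in `t` of the tilted dual map at `1 + t B`, with a quadratic bound on the
remainder. -/
theorem OQRW.norm_dualMap_exp_sub_le {a : W.S → ℝ}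
    (hE : Summable fun s => Real.exp (2 * |a s|) * ‖W.L s‖ ^ 2) (B : 𝔥 →L[ℂ] 𝔥)
    {t : ℝ} (h0 : 0 ≤ t) (h1 : t ≤ 1) :
    ‖W.dualMap (fun s => Real.exp (t * a s)) (1 + t • B) -
        (1 + t • (W.dualMap a 1 + W.dualMap 1 B))‖ ≤
      t ^ 2 * ((2 + ‖B‖) * ∑' s, Real.exp (2 * |a s|) * ‖W.L s‖ ^ 2) := by
  have hs1 := W.hasSum_dualMap (W.summable_weight_exp h0 h1 hE) (1 + t • B)
  have hs2 := W.hasSum_dualMap (W.summable_weight_self hE) 1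
  have hs3 := W.hasSum_dualMap (W.summable_weight_one hE) B
  have hs4 := W.hasSum_dualMap (W.summable_weight_one hE) 1
  rw [W.dualMap_one_one] at hs4
  have hs := hs1.sub (hs4.add ((hs2.add hs3).const_smul t))
  rw [← hs.tsum_eq]
  refine tsum_of_norm_bounded ((hE.hasSum.mul_left (2 + ‖B‖)).mul_left (t ^ 2)) fun s => ?_
  have e : Real.exp (t * a s) • (adjoint (W.L s) * (1 + t • B) * W.L s) -
      ((1 : W.S → ℝ) s • (adjoint (W.L s) * 1 * W.L s) +
        t • (a s • (adjoint (W.L s) * 1 * W.L s) +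
          (1 : W.S → ℝ) s • (adjoint (W.L s) * B * W.L s))) =
      (Real.exp (t * a s) - 1 - t * a s) • (adjoint (W.L s) * 1 * W.L s) +
        (t * (Real.exp (t * a s) - 1)) • (adjoint (W.L s) * B * W.L s) := by
    rw [mul_add, add_mul, mul_smul_comm, smul_mul_assoc, Pi.one_apply]
    module
  rw [e]
  have hL1 : ‖adjoint (W.L s) * 1 * W.L s‖ ≤ ‖W.L s‖ ^ 2 := by
    rw [mul_one]
    calc ‖adjoint (W.L s) * W.L s‖ ≤ ‖adjoint (W.L s)‖ * ‖W.L s‖ := norm_mul_le _ _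
      _ = ‖W.L s‖ ^ 2 := by rw [LinearIsometryEquiv.norm_map]; ring
  calc _ ≤ |Real.exp (t * a s) - 1 - t * a s| * ‖adjoint (W.L s) * 1 * W.L s‖ +
        |t * (Real.exp (t * a s) - 1)| * ‖adjoint (W.L s) * B * W.L s‖ := by
        refine (norm_add_le _ _).trans_eq ?_
        rw [norm_smul, norm_smul, Real.norm_eq_abs, Real.norm_eq_abs]
    _ ≤ 2 * t ^ 2 * Real.exp (2 * |a s|) * ‖W.L s‖ ^ 2 +
        t ^ 2 * Real.exp (2 * |a s|) * (‖W.L s‖ ^ 2 * ‖B‖) :=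
      add_le_add
        (mul_le_mul (abs_exp_sub_one_sub_mul_le h0 h1) hL1 (norm_nonneg _) (by positivity))
        (mul_le_mul (abs_mul_exp_sub_one_le h0 h1) (norm_adjoint_mul_mul_le _ _) (norm_nonneg _)
          (by positivity))
    _ = t ^ 2 * ((2 + ‖B‖) * (Real.exp (2 * |a s|) * ‖W.L s‖ ^ 2)) := by ring

/-- If `B` solves the Poisson equation `B - 𝔏^* B = ∑_s a_s L_s^* L_s - c`, then for small `t ≥ 0`
the operator `1 + t B` is a positive subeigenvector of the tilted dual map, for the rate
`exp (c t + O(t ^ 2))`. This replaces the analytic perturbation theory of the leading eigenvalue. -/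
theorem OQRW.exists_tilted_subeigenvector {a : W.S → ℝ}
    (hE : Summable fun s => Real.exp (2 * |a s|) * ‖W.L s‖ ^ 2) {B : 𝔥 →L[ℂ] 𝔥} {c : ℝ}
    (hB : IsSelfAdjoint B)
    (hP : B - W.dualMap 1 B = W.dualMap a 1 - c • (1 : 𝔥 →L[ℂ] 𝔥)) :
    ∃ C δ : ℝ, 0 ≤ C ∧ 0 < δ ∧ δ ≤ 1 ∧ ∀ t, 0 ≤ t → t ≤ δ → ∃ A : 𝔥 →L[ℂ] 𝔥,
      (1 / 2 : ℝ) • (1 : 𝔥 →L[ℂ] 𝔥) ≤ A ∧ A ≤ (2 : ℝ) • (1 : 𝔥 →L[ℂ] 𝔥) ∧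
      W.dualMap (fun s => Real.exp (t * a s)) A ≤ Real.exp (c * t + C * t ^ 2) • A := by
  set D : ℝ := (2 + ‖B‖) * ∑' s, Real.exp (2 * |a s|) * ‖W.L s‖ ^ 2 with hD
  have hD0 : 0 ≤ D := by
    have : 0 ≤ ∑' s, Real.exp (2 * |a s|) * ‖W.L s‖ ^ 2 := tsum_nonneg fun s => by positivity
    positivity
  -- `t ≤ δ` gives `‖t B‖ ≤ 1 / 2`; the constant `C` makes `C t ^ 2 (1 + t B)` dominate both the
  -- remainder, of size `D t ^ 2`, and the cross term `c t ^ 2 B`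
  refine ⟨2 * (D + |c| * ‖B‖), 1 / (2 * (1 + ‖B‖)), by positivity, by positivity, ?_, ?_⟩
  · rw [div_le_one (by positivity)]
    linarith [norm_nonneg B]
  intro t h0 ht
  have h1 : t ≤ 1 := ht.trans (by rw [div_le_one (by positivity)]; linarith [norm_nonneg B])
  have htB : ‖t • B‖ ≤ 1 / 2 := by
    rw [norm_smul, Real.norm_eq_abs, abs_of_nonneg h0]
    rw [le_div_iff₀ (by positivity)] at ht
    linarith
  have hsa : IsSelfAdjoint (t • B) := (IsSelfAdjoint.all t).smul hB
  have hup := le_smul_one_of_norm_le hsa htB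
  have hlow := le_smul_one_of_norm_le hsa.neg ((norm_neg (t • B)).trans_le htB)
  have hA1 : (1 / 2 : ℝ) • (1 : 𝔥 →L[ℂ] 𝔥) ≤ 1 + t • B := by
    rw [← sub_nonneg] at hlow ⊢
    convert hlow using 1
    module
  have hA0 : 0 ≤ 1 + t • B := le_trans (smul_nonneg (by norm_num) zero_le_one) hA1
  refine ⟨1 + t • B, hA1, ?_, ?_⟩
  · have h32 : (3 / 2 : ℝ) • (1 : 𝔥 →L[ℂ] 𝔥) ≤ (2 : ℝ) • (1 : 𝔥 →L[ℂ] 𝔥) :=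
      smul_le_smul_of_nonneg_right (by norm_num) zero_le_one
    refine le_trans ?_ h32
    rw [← sub_nonneg] at hup ⊢
    convert hup using 1
    module
  set R := W.dualMap (fun s => Real.exp (t * a s)) (1 + t • B) -
        (1 + t • (W.dualMap a 1 + W.dualMap 1 B)) with hR
  have hRn : ‖R‖ ≤ t ^ 2 * D := W.norm_dualMap_exp_sub_le hE B h0 h1
  have hRsa : IsSelfAdjoint R :=
    (W.isSelfAdjoint_dualMap (W.summable_weight_exp h0 h1 hE) ((IsSelfAdjoint.one _).add hsa)).sub
      ((IsSelfAdjoint.one _).add ((IsSelfAdjoint.all t).smul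
        ((W.isSelfAdjoint_dualMap (W.summable_weight_self hE) (IsSelfAdjoint.one _)).add
          (W.isSelfAdjoint_dualMap (W.summable_weight_one hE) hB))))
  have hQ : R - (t ^ 2 * c) • B ≤ (t ^ 2 * (D + |c| * ‖B‖)) • (1 : 𝔥 →L[ℂ] 𝔥) := by
    refine le_smul_one_of_norm_le (hRsa.sub ((IsSelfAdjoint.all _).smul hB)) ?_
    calc ‖R - (t ^ 2 * c) • B‖ ≤ ‖R‖ + ‖(t ^ 2 * c) • B‖ := norm_sub_le _ _
      _ ≤ t ^ 2 * D + t ^ 2 * |c| * ‖B‖ := by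
          rw [norm_smul, Real.norm_eq_abs, abs_mul, abs_of_nonneg (sq_nonneg t)]
          gcongr
      _ = t ^ 2 * (D + |c| * ‖B‖) := by ring
  have hsum : W.dualMap a 1 + W.dualMap 1 B = B + c • (1 : 𝔥 →L[ℂ] 𝔥) := by
    rw [sub_eq_iff_eq_add] at hP
    nth_rewrite 2 [hP]
    abel
  have hkey : W.dualMap (fun s => Real.exp (t * a s)) (1 + t • B) =
      1 + t • (B + c • (1 : 𝔥 →L[ℂ] 𝔥)) + R := by
    rw [hR, hsum]; abel
  calc W.dualMap (fun s => Real.exp (t * a s)) (1 + t • B)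
      = (1 + c * t) • (1 + t • B) + (R - (t ^ 2 * c) • B) := by rw [hkey]; module
    _ ≤ (1 + c * t) • (1 + t • B) + (t ^ 2 * (D + |c| * ‖B‖)) • (1 : 𝔥 →L[ℂ] 𝔥) := by gcongr
    _ = (1 + c * t) • (1 + t • B) +
          (2 * (D + |c| * ‖B‖) * t ^ 2) • ((1 / 2 : ℝ) • (1 : 𝔥 →L[ℂ] 𝔥)) := by module
    _ ≤ (1 + c * t) • (1 + t • B) + (2 * (D + |c| * ‖B‖) * t ^ 2) • (1 + t • B) :=
        add_le_add_right (smul_le_smul_of_nonneg_left hA1 (by positivity)) _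
    _ = (1 + c * t + 2 * (D + |c| * ‖B‖) * t ^ 2) • (1 + t • B) := by module
    _ ≤ Real.exp (c * t + 2 * (D + |c| * ‖B‖) * t ^ 2) • (1 + t • B) := by
        refine smul_le_smul_of_nonneg_right ?_ hA0
        linarith [Real.add_one_le_exp (c * t + 2 * (D + |c| * ‖B‖) * t ^ 2)]

variable [FiniteDimensional ℂ 𝔥]

theorem tr_eq_ofReal_re {A : 𝔥 →L[ℂ] 𝔥} (hA : 0 ≤ A) : tr A = ((tr A).re : ℂ) := by
  have h : (A : 𝔥 →ₗ[ℂ] 𝔥).IsPositive :=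
    (isPositive_toLinearMap_iff A).2 ((nonneg_iff_isPositive A).1 hA)
  exact Complex.ext rfl (Complex.le_def.1 h.trace_nonneg).2.symm

/-- The self-adjoint solution of the Poisson equation for the weights `a`, whose mean in the
invariant state is subtracted. -/
theorem OQRW.exists_isSelfAdjoint_poisson [Nontrivial 𝔥] {a : W.S → ℝ}
    (hE : Summable fun s => Real.exp (2 * |a s|) * ‖W.L s‖ ^ 2)
    (h : Summable fun s : W.S => ‖W.L s‖ ^ 2)
    (hirr : IsIrreducible W.aux) {ρ : 𝔥 →L[ℂ] 𝔥} (hρ : IsState ρ) (hinv : W.aux ρ = ρ) {c : ℝ}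
    (hc : HasSum (fun s => a s * (tr (W.L s * ρ * adjoint (W.L s))).re) c) :
    ∃ B : 𝔥 →L[ℂ] 𝔥, IsSelfAdjoint B ∧
      B - W.dualMap 1 B = W.dualMap a 1 - c • (1 : 𝔥 →L[ℂ] 𝔥) := by
  have hρ0 : 0 ≤ ρ := (nonneg_iff_isPositive ρ).2 hρ.1
  have htr : tr (W.dualMap a 1 * ρ) = c := by
    have h1 := trCLM.hasSum ((W.hasSum_dualMap (W.summable_weight_self hE) 1).mul_right ρ)
    refine h1.unique ((Complex.hasSum_ofReal.2 hc).congr_fun fun s => ?_)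
    change trCLM ((a s • (adjoint (W.L s) * 1 * W.L s)) * ρ) = _
    rw [mul_one, smul_mul_assoc, mul_assoc, RCLike.real_smul_eq_coe_smul (K := ℂ), map_smul,
      trCLM_apply, tr_mul_comm, tr_eq_ofReal_re (mul_mul_adjoint_nonneg hρ0 (W.L s))]
    simp
  have h0 : tr ((W.dualMap a 1 - c • (1 : 𝔥 →L[ℂ] 𝔥)) * ρ) = 0 := by
    rw [sub_mul, smul_mul_assoc, one_mul, RCLike.real_smul_eq_coe_smul (K := ℂ), ← trCLM_apply,
      map_sub, map_smul, trCLM_apply, trCLM_apply, htr, hρ.2]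
    simp
  obtain ⟨B, hB⟩ := W.exists_poisson h hirr hρ hinv h0
  have hsa : IsSelfAdjoint (W.dualMap a 1 - c • (1 : 𝔥 →L[ℂ] 𝔥)) :=
    (W.isSelfAdjoint_dualMap (W.summable_weight_self hE) (IsSelfAdjoint.one _)).sub
      (isSelfAdjoint_smul_one c)
  have hB' : star B - W.dualMap 1 (star B) = W.dualMap a 1 - c • (1 : 𝔥 →L[ℂ] 𝔥) := by
    rw [W.dualMap_star (W.summable_one_weight h), ← star_sub, hB, hsa.star_eq]
  refine ⟨(1 / 2 : ℂ) • (B + star B), ?_, ?_⟩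
  · rw [IsSelfAdjoint, star_smul, star_add, star_star, add_comm (star B)]
    simp
  · rw [← W.dualLin_apply h, map_smul, map_add, W.dualLin_apply, W.dualLin_apply]
    have e : (1 / 2 : ℂ) • (B + star B) - (1 / 2 : ℂ) • (W.dualMap 1 B + W.dualMap 1 (star B)) =
        (1 / 2 : ℂ) • ((B - W.dualMap 1 B) + (star B - W.dualMap 1 (star B))) := by module
    rw [e, hB, hB']
    module

end Tilt

/-! ### Exponential moments of the displacement -/

section Paths

variable {𝔥 : Type*} [NormedAddCommGroup 𝔥] [InnerProductSpace ℂ 𝔥] [CompleteSpace 𝔥]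
  [FiniteDimensional ℂ 𝔥]
  {d : ℕ} {V : AddSubgroup (EuclideanSpace ℝ (Fin d))} (W : OQRW V 𝔥)

theorem OQRW.hasSum_mul_tr_step {f : V → ℝ}
    (hf : Summable fun s : W.S => |f s| * ‖W.L s‖ ^ 2) (A σ : 𝔥 →L[ℂ] 𝔥) :
    HasSum (fun v : V => f v * (tr (A * W.step v σ)).re)
      (tr (W.dualMap (fun s => f s) A * σ)).re := by
  have h1 : HasSum (fun s : W.S => f s * (tr (A * W.step s σ)).re)
      (tr (W.dualMap (fun s => f s) A * σ)).re := by
    have h2 := Complex.hasSum_re (trCLM.hasSum ((W.hasSum_dualMap hf A).mul_right σ))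
    refine h2.congr_fun fun s => ?_
    have e : W.step (s : V) σ = W.L s * σ * adjoint (W.L s) := by simp [OQRW.step]
    have e2 : tr (adjoint (W.L s) * A * W.L s * σ) = tr (A * (W.L s * σ * adjoint (W.L s))) := by
      rw [mul_assoc, mul_assoc, tr_mul_comm]
      simp only [mul_assoc]
    rw [e, smul_mul_assoc, RCLike.real_smul_eq_coe_smul (K := ℂ), map_smul, trCLM_apply, e2]
    simp
  refine (Function.Injective.hasSum_iff Subtype.val_injective ?_).1 h1
  intro v hv
  have : v ∉ W.S := by simpa using hv
  simp [OQRW.step, this, tr]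

/-- A finite path `y_0, …, y_p`, prolonged by its last value. -/
def prolong {p : ℕ} (y : Fin (p + 1) → V) (k : ℕ) : V := y (Fin.ofNat (p + 1) (min k p))

theorem prolong_apply {p : ℕ} (y : Fin (p + 1) → V) (i : Fin (p + 1)) : prolong y i = y i := by
  unfold prolong
  congr 1
  ext
  simp only [Fin.val_ofNat]
  have := i.2
  rw [min_eq_left (by omega), Nat.mod_eq_of_lt this]

theorem prolong_snoc {p : ℕ} (y : Fin (p + 1) → V) (v : V) {k : ℕ} (hk : k ≤ p) :
    prolong (Fin.snoc (α := fun _ => V) y v : Fin (p + 2) → V) k = prolong y k := by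
  have h1 := prolong_apply (Fin.snoc (α := fun _ => V) y v : Fin (p + 2) → V)
    (Fin.castSucc ⟨k, by omega⟩)
  have h2 := prolong_apply y ⟨k, by omega⟩
  rw [Fin.snoc_castSucc] at h1
  exact h1.trans h2.symm

theorem prolong_snoc_last {p : ℕ} (y : Fin (p + 1) → V) (v : V) :
    prolong (Fin.snoc (α := fun _ => V) y v : Fin (p + 2) → V) (p + 1) = v := by
  have h1 := prolong_apply (Fin.snoc (α := fun _ => V) y v : Fin (p + 2) → V) (Fin.last _)
  rwa [Fin.snoc_last] at h1

/-- The sum over all paths `y_0, …, y_p` of `e^{f(y_p - y_0)} Tr(A ρ_y)`, where `ρ_y` is the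
unnormalised state after the path `y`. For `A = 1` it is the expectation of `e^{f(X_p - X_0)}`. -/
def OQRW.tiltedSum (W : OQRW V 𝔥) (ρ : DiagState V 𝔥) (f : V →+ ℝ) (p : ℕ) (A : 𝔥 →L[ℂ] 𝔥) :
    ENNReal :=
  ∑' y : Fin (p + 1) → V, ENNReal.ofReal
    (Real.exp (f (prolong y p - prolong y 0)) * (tr (A * W.pathState ρ (prolong y) p)).re)

variable (ρ : DiagState V 𝔥) (f : V →+ ℝ)

theorem OQRW.pathState_nonneg (x : ℕ → V) (p : ℕ) : 0 ≤ W.pathState ρ x p :=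
  (nonneg_iff_isPositive _).2 (W.pathState_isPositive ρ x p)

theorem OQRW.step_nonneg (v : V) {σ : 𝔥 →L[ℂ] 𝔥} (hσ : 0 ≤ σ) : 0 ≤ W.step v σ :=
  (nonneg_iff_isPositive _).2 (W.step_isPositive v ((nonneg_iff_isPositive _).1 hσ))

theorem OQRW.tiltedSum_mono (p : ℕ) {A A' : 𝔥 →L[ℂ] 𝔥} (h : A ≤ A') :
    W.tiltedSum ρ f p A ≤ W.tiltedSum ρ f p A' := by
  refine ENNReal.tsum_le_tsum fun y => ENNReal.ofReal_le_ofReal ?_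
  exact mul_le_mul_of_nonneg_left (tr_re_mul_le_mul h (W.pathState_nonneg ρ _ _))
    (Real.exp_pos _).le

theorem OQRW.tiltedSum_smul (p : ℕ) {r : ℝ} (hr : 0 ≤ r) (A : 𝔥 →L[ℂ] 𝔥) :
    W.tiltedSum ρ f p (r • A) = ENNReal.ofReal r * W.tiltedSum ρ f p A := by
  unfold OQRW.tiltedSum
  rw [← ENNReal.tsum_mul_left]
  refine tsum_congr fun y => ?_
  rw [← ENNReal.ofReal_mul hr, smul_mul_assoc, RCLike.real_smul_eq_coe_smul (K := ℂ),
    ← trCLM_apply, map_smul, trCLM_apply]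
  congr 1
  simp
  ring

theorem OQRW.tiltedSum_zero (A : 𝔥 →L[ℂ] 𝔥) :
    W.tiltedSum ρ f 0 A = ∑' v : V, ENNReal.ofReal (tr (A * ρ.block v)).re := by
  unfold OQRW.tiltedSum
  rw [← (Equiv.funUnique (Fin 1) V).symm.tsum_eq]
  refine tsum_congr fun v => ?_
  rw [sub_self, map_zero, Real.exp_zero, one_mul]
  rfl

/-- Summing over the last step transfers it to `A` through the tilted dual map. -/
theorem OQRW.tiltedSum_succ (hf : Summable fun s : W.S => |Real.exp (f s)| * ‖W.L s‖ ^ 2)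
    (p : ℕ) {A : 𝔥 →L[ℂ] 𝔥} (hA : 0 ≤ A) :
    W.tiltedSum ρ f (p + 1) A = W.tiltedSum ρ f p (W.dualMap (fun s => Real.exp (f s)) A) := by
  unfold OQRW.tiltedSum
  rw [← (Fin.snocEquiv (fun _ : Fin (p + 2) => V)).tsum_eq, ENNReal.tsum_prod', ENNReal.tsum_comm]
  refine tsum_congr fun y => ?_
  have hps : ∀ v : V, W.pathState ρ
      (prolong (Fin.snoc (α := fun _ => V) y v : Fin (p + 2) → V)) (p + 1) =
        W.step (v - prolong y p) (W.pathState ρ (prolong y) p) := by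
    intro v
    rw [OQRW.pathState, prolong_snoc_last, prolong_snoc y v le_rfl,
      W.pathState_congr ρ fun k hk => prolong_snoc y v hk]
  have h1 : ∀ v : V, ENNReal.ofReal (Real.exp (f (prolong (Fin.snocEquiv (fun _ => V) (v, y)) (p + 1)
      - prolong (Fin.snocEquiv (fun _ => V) (v, y)) 0)) *
        (tr (A * W.pathState ρ (prolong (Fin.snocEquiv (fun _ => V) (v, y))) (p + 1))).re) =
      ENNReal.ofReal (Real.exp (f (v - prolong y 0)) *
        (tr (A * W.step (v - prolong y p) (W.pathState ρ (prolong y) p))).re) := by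
    intro v
    change ENNReal.ofReal (Real.exp (f (prolong (Fin.snoc (α := fun _ => V) y v : Fin (p + 2) → V)
      (p + 1) - prolong (Fin.snoc (α := fun _ => V) y v : Fin (p + 2) → V) 0)) *
        (tr (A * W.pathState ρ
          (prolong (Fin.snoc (α := fun _ => V) y v : Fin (p + 2) → V)) (p + 1))).re) = _
    rw [hps, prolong_snoc_last, prolong_snoc y v (Nat.zero_le p)]
  refine (tsum_congr h1).trans ?_
  rw [← (Equiv.addRight (prolong y p)).tsum_eq]
  have hs := (W.hasSum_mul_tr_step (f := fun v => Real.exp (f v)) hf A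
    (W.pathState ρ (prolong y) p)).mul_left (Real.exp (f (prolong y p - prolong y 0)))
  rw [← hs.tsum_eq, ENNReal.ofReal_tsum_of_nonneg _ hs.summable]
  · refine tsum_congr fun v => ?_
    rw [Equiv.coe_addRight, add_sub_cancel_right, add_sub_assoc, map_add, Real.exp_add]
    congr 1
    ring
  · intro v
    have := tr_re_mul_nonneg hA (W.step_nonneg v (W.pathState_nonneg ρ (prolong y) p))
    positivity

theorem OQRW.tiltedSum_le (hf : Summable fun s : W.S => |Real.exp (f s)| * ‖W.L s‖ ^ 2)
    {A : 𝔥 →L[ℂ] 𝔥} (hA : 0 ≤ A) (hA2 : A ≤ (2 : ℝ) • (1 : 𝔥 →L[ℂ] 𝔥)) {r : ℝ} (hr : 0 ≤ r)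
    (hsub : W.dualMap (fun s => Real.exp (f s)) A ≤ r • A) (p : ℕ) :
    W.tiltedSum ρ f p A ≤ ENNReal.ofReal (2 * r ^ p) := by
  induction p with
  | zero =>
    refine (W.tiltedSum_mono ρ f 0 hA2).trans ?_
    have hs := Complex.hasSum_re ρ.hasSum_tr
    rw [W.tiltedSum_smul ρ f 0 zero_le_two, W.tiltedSum_zero, pow_zero, mul_one]
    simp only [one_mul]
    rw [← ENNReal.ofReal_tsum_of_nonneg (fun i => tr_re_nonneg (ρ.isPositive i)) hs.summable,
      hs.tsum_eq]
    simp
  | succ p ih =>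
    rw [W.tiltedSum_succ ρ f hf p hA]
    calc _ ≤ W.tiltedSum ρ f p (r • A) := W.tiltedSum_mono ρ f p hsub
      _ = ENNReal.ofReal r * W.tiltedSum ρ f p A := W.tiltedSum_smul ρ f p hr A
      _ ≤ ENNReal.ofReal r * ENNReal.ofReal (2 * r ^ p) := by gcongr
      _ = ENNReal.ofReal (2 * r ^ (p + 1)) := by
          rw [← ENNReal.ofReal_mul hr]; congr 1; ring

theorem OQRW.lintegral_exp_eq_tiltedSum [DiscreteTopology V] (p : ℕ) :
    ∫⁻ ω, ENNReal.ofReal (Real.exp (f (ω p - ω 0))) ∂(W.law ρ) = W.tiltedSum ρ f p 1 := by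
  have : Countable V := countable_of_discrete
  let r : (ℕ → V) → (Fin (p + 1) → V) := fun ω i => ω i
  have hr : Measurable r := by fun_prop
  have hg : Measurable fun y : Fin (p + 1) → V =>
      ENNReal.ofReal (Real.exp (f (prolong y p - prolong y 0))) := measurable_of_countable _
  have hrp : ∀ ω : ℕ → V, ∀ k ≤ p, prolong (r ω) k = ω k := by
    intro ω k hk
    exact prolong_apply (r ω) ⟨k, by omega⟩
  have h1 : ∫⁻ ω, ENNReal.ofReal (Real.exp (f (ω p - ω 0))) ∂(W.law ρ) =
      ∫⁻ y, ENNReal.ofReal (Real.exp (f (prolong y p - prolong y 0))) ∂((W.law ρ).map r) := by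
    rw [lintegral_map hg hr]
    refine lintegral_congr fun ω => ?_
    rw [hrp ω p le_rfl, hrp ω 0 (Nat.zero_le p)]
  rw [h1, lintegral_countable']
  refine tsum_congr fun y => ?_
  have h2 : r ⁻¹' {y} = {ω | ∀ k ≤ p, ω k = prolong y k} := by
    ext ω
    simp only [Set.mem_preimage, Set.mem_singleton_iff, Set.mem_ofPred_eq]
    constructor
    · rintro rfl k hk
      exact (hrp ω k hk).symm
    · intro h
      ext1 i
      rw [← prolong_apply y i]
      exact h i (by omega)
  rw [Measure.map_apply hr (measurableSet_singleton y), h2, (W.law_spec ρ).2, one_mul,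
    ← ENNReal.ofReal_mul (Real.exp_pos _).le]

theorem OQRW.measure_le_tiltedSum_div [DiscreteTopology V] (p : ℕ) (b : ℝ) :
    W.law ρ {ω | b ≤ f (ω p - ω 0)} ≤
      W.tiltedSum ρ f p 1 / ENNReal.ofReal (Real.exp b) := by
  have : Countable V := countable_of_discrete
  rw [← W.lintegral_exp_eq_tiltedSum ρ f p]
  have hmeas : Measurable fun ω : ℕ → V => ENNReal.ofReal (Real.exp (f (ω p - ω 0))) := by
    have h1 : Measurable fun z : V × V => ENNReal.ofReal (Real.exp (f (z.1 - z.2))) :=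
      measurable_of_countable _
    have h2 : Measurable fun ω : ℕ → V => (ω p, ω 0) := by fun_prop
    exact h1.comp h2
  refine (measure_mono fun ω hω => ?_).trans (meas_ge_le_lintegral_div hmeas.aemeasurable
    (ENNReal.ofReal_pos.2 (Real.exp_pos b)).ne' ENNReal.ofReal_ne_top)
  exact ENNReal.ofReal_le_ofReal (Real.exp_le_exp.2 hω)

/-- Chernoff bound in one direction: the displacement exceeds its mean rate `c` along `u` by a
margin `η` with exponentially small probability. -/
theorem OQRW.exists_chernoff [DiscreteTopology V] {u : EuclideanSpace ℝ (Fin d)} {c : ℝ}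
    {B : 𝔥 →L[ℂ] 𝔥}
    (hE : Summable fun s : W.S => Real.exp (2 * |⟪u, ((s : V) : EuclideanSpace ℝ (Fin d))⟫_ℝ|) *
      ‖W.L s‖ ^ 2)
    (hB : IsSelfAdjoint B)
    (hP : B - W.dualMap 1 B = W.dualMap
      (fun s => ⟪u, ((s : V) : EuclideanSpace ℝ (Fin d))⟫_ℝ) 1 - c • (1 : 𝔥 →L[ℂ] 𝔥))
    {η : ℝ} (hη : 0 < η) :
    ∃ K : ℝ, 0 < K ∧ ∀ p : ℕ,
      W.law ρ {ω | (p : ℝ) * (c + η) ≤ ⟪u, ((ω p - ω 0 : V) : EuclideanSpace ℝ (Fin d))⟫_ℝ} ≤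
        ENNReal.ofReal (4 * Real.exp (-((p : ℝ) * K))) := by
  obtain ⟨C, δ, hC, hδ, hδ1, H⟩ := W.exists_tilted_subeigenvector hE hB hP
  -- `t` is small enough for `C t ^ 2` to be absorbed in half of the gain `t η`
  set t : ℝ := min δ (η / (2 * (C + 1))) with ht
  have ht0 : 0 < t := lt_min hδ (by positivity)
  have htC : C * t ≤ η / 2 := by
    have h1 : t ≤ η / (2 * (C + 1)) := min_le_right _ _
    rw [le_div_iff₀ (by positivity)] at h1
    nlinarith
  obtain ⟨A, hA1, hA2, hsub⟩ := H t ht0.le (min_le_left _ _)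
  have hA0 : 0 ≤ A := le_trans (smul_nonneg (by norm_num) zero_le_one) hA1
  let f : V →+ ℝ :=
    { toFun := fun v => t * ⟪u, (v : EuclideanSpace ℝ (Fin d))⟫_ℝ
      map_zero' := by simp
      map_add' := fun v w => by
        change t * ⟪u, (v : EuclideanSpace ℝ (Fin d)) + (w : EuclideanSpace ℝ (Fin d))⟫_ℝ = _
        rw [inner_add_right, mul_add] }
  have hf : Summable fun s : W.S => |Real.exp (f s)| * ‖W.L s‖ ^ 2 :=
    W.summable_weight_exp ht0.le ((min_le_left _ _).trans hδ1) hE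
  refine ⟨t * η / 2, by positivity, fun p => ?_⟩
  set r := Real.exp (c * t + C * t ^ 2) with hr
  have hint : W.tiltedSum ρ f p 1 ≤ ENNReal.ofReal (4 * r ^ p) := by
    have h1A : (1 : 𝔥 →L[ℂ] 𝔥) ≤ (2 : ℝ) • A := by
      have := smul_le_smul_of_nonneg_left hA1 (zero_le_two (α := ℝ))
      rwa [smul_smul, show (2 : ℝ) * (1 / 2) = 1 by norm_num, one_smul] at this
    calc _ ≤ W.tiltedSum ρ f p ((2 : ℝ) • A) := W.tiltedSum_mono ρ f p h1A
      _ = ENNReal.ofReal 2 * W.tiltedSum ρ f p A := W.tiltedSum_smul ρ f p zero_le_two A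
      _ ≤ ENNReal.ofReal 2 * ENNReal.ofReal (2 * r ^ p) := by
          gcongr
          exact W.tiltedSum_le ρ f hf hA0 hA2 (Real.exp_pos _).le hsub p
      _ = ENNReal.ofReal (4 * r ^ p) := by
          rw [← ENNReal.ofReal_mul zero_le_two]; congr 1; ring
  have hpos : 0 < Real.exp (t * (p * (c + η))) := Real.exp_pos _
  have hsubset : {ω : ℕ → V | (p : ℝ) * (c + η) ≤
      ⟪u, ((ω p - ω 0 : V) : EuclideanSpace ℝ (Fin d))⟫_ℝ} ⊆
      {ω | t * (p * (c + η)) ≤ f (ω p - ω 0)} :=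
    fun ω hω => mul_le_mul_of_nonneg_left hω ht0.le
  calc _ ≤ W.law ρ {ω | t * (p * (c + η)) ≤ f (ω p - ω 0)} := measure_mono hsubset
    _ ≤ W.tiltedSum ρ f p 1 / ENNReal.ofReal (Real.exp (t * (p * (c + η)))) :=
        W.measure_le_tiltedSum_div ρ f p _
    _ ≤ ENNReal.ofReal (4 * r ^ p) / ENNReal.ofReal (Real.exp (t * (p * (c + η)))) := by gcongr
    _ = ENNReal.ofReal (4 * r ^ p / Real.exp (t * (p * (c + η)))) :=
        (ENNReal.ofReal_div_of_pos hpos).symm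
    _ ≤ ENNReal.ofReal (4 * Real.exp (-((p : ℝ) * (t * η / 2)))) := by
        refine ENNReal.ofReal_le_ofReal ?_
        rw [hr, ← Real.exp_nat_mul, mul_div_assoc, ← Real.exp_sub]
        refine mul_le_mul_of_nonneg_left (Real.exp_le_exp.2 ?_) (by norm_num)
        have h2 : (p : ℝ) * (t * (C * t)) ≤ p * (t * (η / 2)) := by gcongr
        linarith

end Paths

/-! ### Convergence to the drift -/

section Drift

theorem norm_le_sum_abs {d : ℕ} (x : EuclideanSpace ℝ (Fin d)) : ‖x‖ ≤ ∑ i, |x i| := by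
  have h := (EuclideanSpace.basisFun (Fin d) ℝ).sum_repr x
  calc ‖x‖ = ‖∑ i, x i • EuclideanSpace.basisFun (Fin d) ℝ i‖ := by
        conv_lhs => rw [← h]
        rfl
    _ ≤ ∑ i, ‖x i • EuclideanSpace.basisFun (Fin d) ℝ i‖ := norm_sum_le _ _
    _ = ∑ i, |x i| := by
        refine Finset.sum_congr rfl fun i _ => ?_
        rw [norm_smul, OrthonormalBasis.norm_eq_one, mul_one, Real.norm_eq_abs]

/-- The vector `± e_i` of the standard basis, with sign `+` for `true`. -/
def signedBasis (d : ℕ) (j : Fin d × Bool) : EuclideanSpace ℝ (Fin d) :=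
  EuclideanSpace.single j.1 (if j.2 then 1 else -1)

theorem inner_signedBasis {d : ℕ} (j : Fin d × Bool) (x : EuclideanSpace ℝ (Fin d)) :
    ⟪signedBasis d j, x⟫_ℝ = if j.2 then x j.1 else -x j.1 := by
  unfold signedBasis
  rw [EuclideanSpace.inner_single_left]
  split_ifs <;> simp

theorem exists_le_inner_signedBasis {d : ℕ} {ε : ℝ} (hε : 0 < ε) {x : EuclideanSpace ℝ (Fin d)}
    (hx : ε < ‖x‖) : ∃ j, ε / (d + 1) ≤ ⟪signedBasis d j, x⟫_ℝ := by
  by_contra! hcon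
  have h1 : ∀ i, |x i| ≤ ε / (d + 1) := by
    intro i
    have ht := hcon (i, true)
    have hf := hcon (i, false)
    rw [inner_signedBasis] at ht hf
    simp only [if_true, Bool.false_eq_true, if_false] at ht hf
    rw [abs_le]
    constructor <;> linarith
  have h2 : ‖x‖ ≤ d * (ε / (d + 1)) := by
    refine (norm_le_sum_abs x).trans ((Finset.sum_le_sum fun i _ => h1 i).trans_eq ?_)
    simp
  have h3 : d * (ε / (d + 1)) ≤ ε := by
    rw [mul_div_assoc', div_le_iff₀ (by positivity)]
    nlinarith
  linarith

variable {𝔥 : Type*} [NormedAddCommGroup 𝔥] [InnerProductSpace ℂ 𝔥] [CompleteSpace 𝔥]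
  {d : ℕ} {V : AddSubgroup (EuclideanSpace ℝ (Fin d))} (W : OQRW V 𝔥)

theorem OQRW.summable_norm_sq
    (hexp : ∀ u : EuclideanSpace ℝ (Fin d), Summable fun s : W.S =>
      Real.exp ⟪u, ((s : V) : EuclideanSpace ℝ (Fin d))⟫_ℝ * ‖W.L s‖ ^ 2) :
    Summable fun s : W.S => ‖W.L s‖ ^ 2 := by
  simpa using hexp 0

theorem OQRW.summable_exp_abs
    (hexp : ∀ u : EuclideanSpace ℝ (Fin d), Summable fun s : W.S =>
      Real.exp ⟪u, ((s : V) : EuclideanSpace ℝ (Fin d))⟫_ℝ * ‖W.L s‖ ^ 2)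
    (u : EuclideanSpace ℝ (Fin d)) :
    Summable fun s : W.S => Real.exp (2 * |⟪u, ((s : V) : EuclideanSpace ℝ (Fin d))⟫_ℝ|) *
      ‖W.L s‖ ^ 2 := by
  refine Summable.of_nonneg_of_le (fun s => by positivity) (fun s => ?_)
    ((hexp ((2 : ℝ) • u)).add (hexp ((-2 : ℝ) • u)))
  rw [← add_mul, real_inner_smul_left, real_inner_smul_left]
  refine mul_le_mul_of_nonneg_right ?_ (by positivity)
  set b := ⟪u, ((s : V) : EuclideanSpace ℝ (Fin d))⟫_ℝ
  rcases abs_cases b with ⟨h, -⟩ | ⟨h, -⟩ <;> rw [h]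
  · linarith [Real.exp_pos (-2 * b)]
  · have : 2 * -b = -2 * b := by ring
    rw [this]
    linarith [Real.exp_pos (2 * b)]

theorem OQRW.summable_norm_mul_norm_sq
    (hexp : ∀ u : EuclideanSpace ℝ (Fin d), Summable fun s : W.S =>
      Real.exp ⟪u, ((s : V) : EuclideanSpace ℝ (Fin d))⟫_ℝ * ‖W.L s‖ ^ 2) :
    Summable fun s : W.S => ‖((s : V) : EuclideanSpace ℝ (Fin d))‖ * ‖W.L s‖ ^ 2 := by
  have h : Summable fun s : W.S => ∑ i : Fin d,
      |⟪signedBasis d (i, true), ((s : V) : EuclideanSpace ℝ (Fin d))⟫_ℝ| * ‖W.L s‖ ^ 2 :=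
    summable_sum fun i _ => W.summable_weight_self (W.summable_exp_abs hexp _)
  refine Summable.of_nonneg_of_le (fun s => by positivity) (fun s => ?_) h
  rw [← Finset.sum_mul]
  refine mul_le_mul_of_nonneg_right ((norm_le_sum_abs _).trans_eq ?_) (by positivity)
  refine Finset.sum_congr rfl fun i _ => ?_
  rw [inner_signedBasis]
  simp

variable [FiniteDimensional ℂ 𝔥]

theorem OQRW.summable_drift
    (hexp : ∀ u : EuclideanSpace ℝ (Fin d), Summable fun s : W.S =>
      Real.exp ⟪u, ((s : V) : EuclideanSpace ℝ (Fin d))⟫_ℝ * ‖W.L s‖ ^ 2) (ρ : 𝔥 →L[ℂ] 𝔥) :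
    Summable fun s : W.S => (tr (W.L s * ρ * adjoint (W.L s))).re •
      ((s : V) : EuclideanSpace ℝ (Fin d)) := by
  refine Summable.of_norm_bounded
    ((W.summable_norm_mul_norm_sq hexp).mul_left (‖(trCLM : (𝔥 →L[ℂ] 𝔥) →L[ℂ] ℂ)‖ * ‖ρ‖))
    fun s => ?_
  have h1 : |(tr (W.L s * ρ * adjoint (W.L s))).re| ≤
      ‖(trCLM : (𝔥 →L[ℂ] 𝔥) →L[ℂ] ℂ)‖ * (‖W.L s‖ ^ 2 * ‖ρ‖) := by
    exact ((Complex.abs_re_le_norm _).trans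
      ((trCLM : (𝔥 →L[ℂ] 𝔥) →L[ℂ] ℂ).le_opNorm _)).trans
      (mul_le_mul_of_nonneg_left (norm_mul_mul_adjoint_le _ _) (opNorm_nonneg _))
  rw [norm_smul, Real.norm_eq_abs]
  calc _ ≤ ‖(trCLM : (𝔥 →L[ℂ] 𝔥) →L[ℂ] ℂ)‖ * (‖W.L s‖ ^ 2 * ‖ρ‖) *
        ‖((s : V) : EuclideanSpace ℝ (Fin d))‖ :=
        mul_le_mul_of_nonneg_right h1 (norm_nonneg _)
    _ = _ := by ring

/-- The component of the drift along `u` is the mean of `⟨u, s⟩`. -/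
theorem OQRW.hasSum_inner_drift
    (hexp : ∀ u : EuclideanSpace ℝ (Fin d), Summable fun s : W.S =>
      Real.exp ⟪u, ((s : V) : EuclideanSpace ℝ (Fin d))⟫_ℝ * ‖W.L s‖ ^ 2) (ρ : 𝔥 →L[ℂ] 𝔥)
    (u : EuclideanSpace ℝ (Fin d)) :
    HasSum (fun s : W.S => ⟪u, ((s : V) : EuclideanSpace ℝ (Fin d))⟫_ℝ *
      (tr (W.L s * ρ * adjoint (W.L s))).re) ⟪u, W.drift ρ⟫_ℝ := by
  refine ((innerSL ℝ u).hasSum (W.summable_drift hexp ρ).hasSum).congr_fun fun s => ?_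
  rw [innerSL_apply_apply, inner_smul_right, mul_comm]

/-- Exponential concentration, with a constant in front, from the union of the one-sided bounds
along the vectors `± e_i`. -/
theorem OQRW.exists_measure_le_mul_exp [Nontrivial 𝔥] [DiscreteTopology V]
    (hexp : ∀ u : EuclideanSpace ℝ (Fin d), Summable fun s : W.S =>
      Real.exp ⟪u, ((s : V) : EuclideanSpace ℝ (Fin d))⟫_ℝ * ‖W.L s‖ ^ 2)
    (hirr : IsIrreducible W.aux) {τ : 𝔥 →L[ℂ] 𝔥} (hτ : IsState τ) (hinv : W.aux τ = τ)
    (ρ : DiagState V 𝔥) {ε : ℝ} (hε : 0 < ε) :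
    ∃ K : ℝ, 0 < K ∧ ∀ p : ℕ, 0 < p →
      W.law ρ {ω | ε < ‖(p : ℝ)⁻¹ • ((ω p : EuclideanSpace ℝ (Fin d)) - ω 0) - W.drift τ‖} ≤
        ENNReal.ofReal (8 * d * Real.exp (-((p : ℝ) * K))) := by
  have hone : ∀ j : Fin d × Bool, ∃ K : ℝ, 0 < K ∧ ∀ p : ℕ,
      W.law ρ {ω | (p : ℝ) * (⟪signedBasis d j, W.drift τ⟫_ℝ + ε / (d + 1)) ≤
        ⟪signedBasis d j, ((ω p - ω 0 : V) : EuclideanSpace ℝ (Fin d))⟫_ℝ} ≤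
        ENNReal.ofReal (4 * Real.exp (-((p : ℝ) * K))) := by
    intro j
    have hE := W.summable_exp_abs hexp (signedBasis d j)
    obtain ⟨B, hB, hP⟩ := W.exists_isSelfAdjoint_poisson hE (W.summable_norm_sq hexp) hirr hτ hinv
      (W.hasSum_inner_drift hexp τ (signedBasis d j))
    exact W.exists_chernoff ρ hE hB hP (by positivity)
  choose K hK0 hK using hone
  obtain ⟨K₀, hK₀, hle⟩ : ∃ K₀ : ℝ, 0 < K₀ ∧ ∀ j, K₀ ≤ K j := by
    have h1 : ∀ᶠ x in 𝓝[>] (0 : ℝ), ∀ j, x ≤ K j :=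
      eventually_all.2 fun j => Filter.Eventually.mono (Ioc_mem_nhdsGT (hK0 j)) fun x hx => hx.2
    obtain ⟨x, hx0, hx⟩ := (eventually_mem_nhdsWithin.and h1).exists
    exact ⟨x, hx0, hx⟩
  refine ⟨K₀, hK₀, fun p hp => ?_⟩
  have hp0 : (0 : ℝ) < p := by exact_mod_cast hp
  have hsub : {ω : ℕ → V | ε < ‖(p : ℝ)⁻¹ • ((ω p : EuclideanSpace ℝ (Fin d)) - ω 0) -
      W.drift τ‖} ⊆ ⋃ j, {ω | (p : ℝ) * (⟪signedBasis d j, W.drift τ⟫_ℝ + ε / (d + 1)) ≤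
        ⟪signedBasis d j, ((ω p - ω 0 : V) : EuclideanSpace ℝ (Fin d))⟫_ℝ} := by
    intro ω hω
    obtain ⟨j, hj⟩ := exists_le_inner_signedBasis hε hω
    refine Set.mem_iUnion.2 ⟨j, ?_⟩
    rw [inner_sub_right, inner_smul_right, le_sub_iff_add_le, add_comm, inv_mul_eq_div,
      le_div_iff₀ hp0, mul_comm] at hj
    exact hj
  calc _ ≤ ∑ j, W.law ρ {ω | (p : ℝ) * (⟪signedBasis d j, W.drift τ⟫_ℝ + ε / (d + 1)) ≤
        ⟪signedBasis d j, ((ω p - ω 0 : V) : EuclideanSpace ℝ (Fin d))⟫_ℝ} :=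
        (measure_mono hsub).trans (measure_iUnion_fintype_le _ _)
    _ ≤ ∑ j : Fin d × Bool, ENNReal.ofReal (4 * Real.exp (-((p : ℝ) * K₀))) := by
        refine Finset.sum_le_sum fun j _ => (hK j p).trans (ENNReal.ofReal_le_ofReal ?_)
        have := hle j
        gcongr
    _ = ENNReal.ofReal (8 * d * Real.exp (-((p : ℝ) * K₀))) := by
        rw [Finset.sum_const, nsmul_eq_mul, ← ENNReal.ofReal_natCast,
          ← ENNReal.ofReal_mul (Nat.cast_nonneg _)]
        congr 1
        simp
        ring

theorem OQRW.exists_eventually_measureReal_le_exp [Nontrivial 𝔥] [DiscreteTopology V]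
    (hexp : ∀ u : EuclideanSpace ℝ (Fin d), Summable fun s : W.S =>
      Real.exp ⟪u, ((s : V) : EuclideanSpace ℝ (Fin d))⟫_ℝ * ‖W.L s‖ ^ 2)
    (hirr : IsIrreducible W.aux) {τ : 𝔥 →L[ℂ] 𝔥} (hτ : IsState τ) (hinv : W.aux τ = τ)
    (ρ : DiagState V 𝔥) {ε : ℝ} (hε : 0 < ε) :
    ∃ N : ℝ, 0 < N ∧ ∀ᶠ p : ℕ in atTop,
      (W.law ρ).real {ω | ε < ‖(p : ℝ)⁻¹ • ((ω p : EuclideanSpace ℝ (Fin d)) - ω 0)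
        - W.drift τ‖} ≤ Real.exp (-((p : ℝ) * N)) := by
  obtain ⟨K, hK, H⟩ := W.exists_measure_le_mul_exp hexp hirr hτ hinv ρ hε
  refine ⟨K / 2, by positivity, ?_⟩
  -- half of the rate absorbs the constant `8 d`
  have hlim : Tendsto (fun p : ℕ => 8 * d * Real.exp (-((p : ℝ) * (K / 2)))) atTop
      (𝓝 (8 * d * 0)) := by
    refine Tendsto.const_mul _ (Real.tendsto_exp_neg_atTop_nhds_zero.comp ?_)
    exact tendsto_natCast_atTop_atTop.atTop_mul_const (by positivity)
  rw [mul_zero] at hlim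
  filter_upwards [hlim.eventually_le_const zero_lt_one, eventually_gt_atTop 0] with p hp hp0
  refine ENNReal.toReal_le_of_le_ofReal (Real.exp_pos _).le
    ((H p hp0).trans (ENNReal.ofReal_le_ofReal ?_))
  calc 8 * d * Real.exp (-((p : ℝ) * K))
      = 8 * d * Real.exp (-((p : ℝ) * (K / 2))) * Real.exp (-((p : ℝ) * (K / 2))) := by
        rw [mul_assoc (8 * (d : ℝ)), ← Real.exp_add]; ring_nf
    _ ≤ 1 * Real.exp (-((p : ℝ) * (K / 2))) := by gcongr
    _ = _ := one_mul _

/-- The strong law follows from exponential concentration by the Borel-Cantelli lemma. -/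
theorem OQRW.ae_tendsto_of_concentration [DiscreteTopology V] (ρ : DiagState V 𝔥)
    {m : EuclideanSpace ℝ (Fin d)}
    (H : ∀ ε : ℝ, 0 < ε → ∃ N : ℝ, 0 < N ∧ ∀ᶠ p : ℕ in atTop,
      (W.law ρ).real {ω | ε < ‖(p : ℝ)⁻¹ • ((ω p : EuclideanSpace ℝ (Fin d)) - ω 0) - m‖} ≤
        Real.exp (-((p : ℝ) * N))) :
    ∀ᵐ ω ∂(W.law ρ), Tendsto (fun p : ℕ => (p : ℝ)⁻¹ • (ω p : EuclideanSpace ℝ (Fin d))) atTop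
      (𝓝 m) := by
  have : IsProbabilityMeasure (W.law ρ) := (W.law_spec ρ).1
  have hbc : ∀ k : ℕ, ∀ᵐ ω ∂(W.law ρ), ∀ᶠ p : ℕ in atTop,
      ¬ (1 / ((k : ℝ) + 1) < ‖(p : ℝ)⁻¹ • ((ω p : EuclideanSpace ℝ (Fin d)) - ω 0) - m‖) := by
    intro k
    obtain ⟨N, hN, hev⟩ := H (1 / ((k : ℝ) + 1)) (by positivity)
    refine ae_eventually_notMem (s := fun p : ℕ => {ω : ℕ → V | 1 / ((k : ℝ) + 1) <
      ‖(p : ℝ)⁻¹ • ((ω p : EuclideanSpace ℝ (Fin d)) - ω 0) - m‖}) ?_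
    have hsum : Summable fun p : ℕ => (W.law ρ).real {ω : ℕ → V | 1 / ((k : ℝ) + 1) <
        ‖(p : ℝ)⁻¹ • ((ω p : EuclideanSpace ℝ (Fin d)) - ω 0) - m‖} := by
      have hgeo : Summable fun p : ℕ => Real.exp (-((p : ℝ) * N)) := by
        have := Real.summable_exp_nat_mul_iff.2 (neg_lt_zero.2 hN)
        simpa [mul_neg] using this
      refine Summable.of_norm_bounded_eventually_nat hgeo ?_
      filter_upwards [hev] with p hp
      rwa [Real.norm_eq_abs, abs_of_nonneg measureReal_nonneg]
    have := hsum.tsum_ofReal_ne_top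
    refine (tsum_congr fun p => ?_).trans_ne this
    exact (ENNReal.ofReal_toReal (measure_ne_top _ _)).symm
  filter_upwards [ae_all_iff.2 hbc] with ω hω
  have h1 : Tendsto (fun p : ℕ => (p : ℝ)⁻¹ • ((ω p : EuclideanSpace ℝ (Fin d)) - ω 0)) atTop
      (𝓝 m) := by
    rw [Metric.tendsto_nhds]
    intro ε hε
    obtain ⟨k, hk⟩ := exists_nat_one_div_lt hε
    filter_upwards [hω k] with p hp
    rw [dist_eq_norm]
    exact (not_lt.1 hp).trans_lt hk
  have h2 : Tendsto (fun p : ℕ => (p : ℝ)⁻¹ • (ω 0 : EuclideanSpace ℝ (Fin d))) atTop (𝓝 0) := by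
    have := (tendsto_inv_atTop_nhds_zero_nat (𝕜 := ℝ)).smul_const
      (ω 0 : EuclideanSpace ℝ (Fin d))
    rwa [zero_smul] at this
  have h3 := h1.add h2
  rw [add_zero] at h3
  refine h3.congr fun p => ?_
  rw [← smul_add, sub_add_cancel]

end Drift

end OpenQuantumWalk

end

theorem mainTheorem4 {d : ℕ} {V : AddSubgroup (EuclideanSpace ℝ (Fin d))} [DiscreteTopology V]
    {𝔥 : Type*} [NormedAddCommGroup 𝔥] [InnerProductSpace ℂ 𝔥] [CompleteSpace 𝔥]
    [FiniteDimensional ℂ 𝔥] [Nontrivial 𝔥]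
    (W : OpenQuantumWalk.OQRW V 𝔥)
    -- automatic when `S` is finite
    (hexp : ∀ u : EuclideanSpace ℝ (Fin d), Summable fun s : W.S =>
      Real.exp ⟪u, ((s : V) : EuclideanSpace ℝ (Fin d))⟫_ℝ * ‖W.L s‖ ^ 2)
    (hirr : OpenQuantumWalk.IsIrreducible W.aux) :
    ∃ ρinv : 𝔥 →L[ℂ] 𝔥,
      -- `ρinv` is the unique invariant state of the auxiliary map
      (OpenQuantumWalk.IsState ρinv ∧ W.aux ρinv = ρinv) ∧
      (∀ σ : 𝔥 →L[ℂ] 𝔥, OpenQuantumWalk.IsState σ → W.aux σ = σ → σ = ρinv) ∧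
      -- the series defining `m = W.drift ρinv` converges
      (Summable fun s : W.S =>
        (OpenQuantumWalk.tr (W.L s * ρinv * adjoint (W.L s))).re •
          ((s : V) : EuclideanSpace ℝ (Fin d))) ∧
      ∀ ρ : OpenQuantumWalk.DiagState V 𝔥,
        (∀ ε : ℝ, 0 < ε → ∃ N : ℝ, 0 < N ∧ ∀ᶠ p : ℕ in atTop,
          (W.law ρ).real {ω | ε < ‖(p : ℝ)⁻¹ • ((ω p : EuclideanSpace ℝ (Fin d)) - ω 0)
            - W.drift ρinv‖} ≤ Real.exp (-((p : ℝ) * N))) ∧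
        (∀ᵐ ω ∂(W.law ρ), Tendsto
          (fun p : ℕ => (p : ℝ)⁻¹ • (ω p : EuclideanSpace ℝ (Fin d))) atTop
          (𝓝 (W.drift ρinv))) := by
  have hL := W.summable_norm_sq hexp
  obtain ⟨τ, hτ, hinv⟩ := W.exists_invariant_state hL
  refine ⟨τ, ⟨hτ, hinv⟩, fun σ hσ hσinv => W.invariant_state_unique hL hirr hτ hinv hσ hσinv,
    W.summable_drift hexp τ, fun ρ => ?_⟩
  have H : ∀ ε : ℝ, 0 < ε → ∃ N : ℝ, 0 < N ∧ ∀ᶠ p : ℕ in atTop,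
      (W.law ρ).real {ω | ε < ‖(p : ℝ)⁻¹ • ((ω p : EuclideanSpace ℝ (Fin d)) - ω 0)
        - W.drift τ‖} ≤ Real.exp (-((p : ℝ) * N)) :=
    fun ε hε => W.exists_eventually_measureReal_le_exp hexp hirr hτ hinv ρ hε
  exact ⟨H, W.ae_tendsto_of_concentration ρ H⟩
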